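/- Let $\mathbb{R}^\infty=\bigcup_n\mathbb{R}^n$, let $BO(2)=\operatorname{colim}_n \mathrm{Gr}_2(\mathbb{R}^n)$ be the Grassmannian of $2$-planes in $\mathbb{R}^\infty$ with its canonical bundle $\gamma$, and let $\theta: X\to BO(2)$ be a Serre fibration. A $\theta$-structure on a rank-2 vector bundle is a bundle map (a continuous fibrewise linear isomorphism) to $\theta^*\gamma$; a $\theta$-structure on a surface is one on its tangent bundle. The cobordism category $C_\theta$ is defined as follows. An object is a pair $(M,\ell)$, where $M\subseteq(-1,1)^n\subseteq\mathbb{R}^n\subseteq\mathbb{R}^\infty$ (for some $n$) is a smooth $1$-dimensional submanifold without boundary which is closed as a subset of $\mathbb{R}^n$, and $\ell:\epsilon^1\oplus TM\to\theta^*\gamma$ is a bundle map. For such an object, $\mathbb{R}\times M$ has the $\theta$-structure $T(\mathbb{R}\times M)\cong\epsilon^1\oplus TM\to\theta^*\gamma$. A non-identity morphism $(M_0,\ell_0)\to(M_1,\ell_1)$ is a pair $(t,W)$ with $t>0$ and $W\subseteq\mathbb{R}\times(-1,1)^n$ (for some $n$) a smooth surface without boundary, closed as a subset of $\mathbb{R}\times\mathbb{R}^n$,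 with a $\theta$-structure, such that for some $\varepsilon>0$, $W$ agrees, as a manifold with $\theta$-structure, with $\mathbb{R}\times M_0$ over $(-\infty,\varepsilon)$ and with $\mathbb{R}\times M_1$ over $(t-\varepsilon,\infty)$ in the first coordinate. Its underlying manifold is the compact cobordism $W\cap([0,t]\times\mathbb{R}^\infty)$. The morphisms of $C_\theta$ are these together with the identities. Suppose that $X$ is path connected and that $S^2$ admits a $\theta$-structure. Then: 1. If $c_0,c_1$ are objects of $C_\theta$ and $W: c_0\to c_1$ is a non-identity morphism whose underlying manifold is connected, then there is a non-identity morphism $\overline W: c_1\to c_0$ whose underlying manifold is diffeomorphic to that of $W$. 2. If two objects $c_0,c_1$ of $C_\theta$ are linked by a zig-zag of morphisms of $C_\theta$ (a finite chain of morphisms, each pointing in either direction), then there exist morphisms $c_0\to c_1$ and $c_1\to c_0$ in $C_\theta$. -/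

import Mathlib

open Set Topology
open scoped ContDiff

noncomputable section

namespace CobCat

/-! ### Euclidean space of infinite dimension -/

/-- The Hilbert space `ℓ²(ℕ)`. It only serves as a convenient normed space that contains all the
Euclidean spaces `ℝⁿ` compatibly and isometrically; every manifold and every plane below is required
to lie in some `ℝⁿ`, that is, in `ℝ^∞ = ⋃ₙ ℝⁿ`. -/
abbrev Ell2 : Type := lp (fun _ : ℕ => ℝ) 2

/-- The subspace `ℝⁿ` of sequences that vanish from index `n` on. -/
def stdSubspace (n : ℕ) : Submodule ℝ Ell2 where
  carrier := {x | ∀ i, n ≤ i → x i = 0}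
  add_mem' := by
    intro a b ha hb i hi
    simp [ha i hi, hb i hi]
  zero_mem' := by
    intro i _
    simp
  smul_mem' := by
    intro c x hx i hi
    simp [hx i hi]

/-! ### The classifying space `BO(d)` and tangential structures -/

/-- `BO(d)`: the Grassmannian of `d`-dimensional linear subspaces of `ℝ^∞ = ⋃ₙ ℝⁿ`. -/
def BO (d : ℕ) : Type :=
  {P : Submodule ℝ Ell2 // Module.finrank ℝ P = d ∧ ∃ n, P ≤ stdSubspace n}

/-- The `d`-frames (linearly independent `d`-tuples) in `ℝⁿ`, with the usual topology. -/
abbrev Frame (d n : ℕ) : Type :=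
  {v : Fin d → Ell2 // (∀ i, v i ∈ stdSubspace n) ∧ LinearIndependent ℝ v}

/-- The plane spanned by a frame. -/
def Frame.plane {d n : ℕ} (v : Frame d n) : BO d :=
  ⟨Submodule.span ℝ (range v.1),
    by simpa using finrank_span_eq_card v.2.2,
    n, Submodule.span_le.2 (by rintro _ ⟨i, rfl⟩; exact v.2.1 i)⟩

/-- The topology of `BO(d) = colimₙ Gr_d(ℝⁿ)`, where `Gr_d(ℝⁿ)` is a quotient of the space of
`d`-frames in `ℝⁿ`: a set of planes is open iff for every `n` the set of frames in `ℝⁿ` which span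
one of these planes is open. -/
instance (d : ℕ) : TopologicalSpace (BO d) :=
  ⨆ n : ℕ, TopologicalSpace.coinduced (Frame.plane : Frame d n → BO d) inferInstance

/-- Serre fibrations: maps with the homotopy lifting property for all cubes. -/
def IsSerreFibration {X B : Type*} [TopologicalSpace X] [TopologicalSpace B] (p : C(X, B)) : Prop :=
  ∀ (n : ℕ) (f : C(Fin n → unitInterval, X)) (H : C(unitInterval × (Fin n → unitInterval), B)),
    (∀ y, H (0, y) = p (f y)) →
      ∃ G : C(unitInterval × (Fin n → unitInterval), X),
        (∀ y, G (0, y) = f y) ∧ ∀ z, p (G z) = H z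

/-- The total space of the pullback `θ^*γ` of the canonical bundle
`γ = {(P, w) : w ∈ P}` over `BO(d)`. (On `γ` the topology induced from `BO(d) × ℓ²` is the usual
one: the transition to local trivialisations only involves finitely many coordinates
of `w` and the plane `P`.) -/
abbrev PullbackGamma {X : Type*} [TopologicalSpace X] {d : ℕ} (θ : C(X, BO d)) : Type _ :=
  {q : X × Ell2 // q.2 ∈ (θ q.1).1}

/-- A bundle map (fibrewise linear isomorphism) to `θ^*γ` from the bundle over the subset `M` whose
fibre at `x ∈ M` is the subspace `V x` of a fixed normed space `F`. -/
structure BundleMap {X : Type*} [TopologicalSpace X] {d : ℕ} (θ : C(X, BO d))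
    {E F : Type*} [NormedAddCommGroup E] [NormedAddCommGroup F] [NormedSpace ℝ F]
    (M : Set E) (V : M → Submodule ℝ F) where
  /-- the map of base spaces -/
  base : C(M, X)
  /-- the linear isomorphisms on fibres; the fibre of `θ^*γ` at `b` is the plane `θ b` -/
  fibre : ∀ x : M, V x ≃ₗ[ℝ] (θ (base x)).1
  /-- the map of total spaces is continuous -/
  continuous_total : Continuous
    (fun p : {p : M × F // p.2 ∈ V p.1} =>
      (⟨(base p.1.1, fibre p.1.1 ⟨p.1.2, p.2⟩), (fibre p.1.1 ⟨p.1.2, p.2⟩).2⟩ : PullbackGamma θ))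

/-! ### Submanifolds of a normed space -/

section Submanifolds

variable {E F : Type*} [NormedAddCommGroup E] [NormedSpace ℝ E]
  [NormedAddCommGroup F] [NormedSpace ℝ F]

/-- `M` is a smooth `d`-dimensional submanifold without boundary: around each of its points there is
a smooth chart of the ambient space which takes `M` to a `d`-dimensional linear subspace. -/
def IsSubmanifold (d : ℕ) (M : Set E) : Prop :=
  ∀ x ∈ M, ∃ (e : OpenPartialHomeomorph E E) (L : Submodule ℝ E),
    x ∈ e.source ∧ ContDiffOn ℝ ∞ e e.source ∧ ContDiffOn ℝ ∞ e.symm e.target ∧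
    FiniteDimensional ℝ L ∧ Module.finrank ℝ L = d ∧
    ∀ y ∈ e.source, (y ∈ M ↔ e y ∈ L)

/-- The tangent space of `M` at `x`, as a subspace of the ambient space. (For a submanifold the
tangent cone is already a linear subspace.) -/
def tangentSpace (M : Set E) (x : E) : Submodule ℝ E :=
  Submodule.span ℝ (tangentConeAt ℝ M x)

/-- A `θ`-structure on `M`: a bundle map `TM → θ^*γ`. -/
abbrev ThetaStructure {X : Type*} [TopologicalSpace X] {d : ℕ} (θ : C(X, BO d)) (M : Set E) :
    Type _ :=
  BundleMap θ M (fun x => tangentSpace M (x : E))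

/-- A `θ`-structure on `ε¹ ⊕ TM`: a bundle map `ε¹ ⊕ TM → θ^*γ`. -/
abbrev ThetaStructureEps {X : Type*} [TopologicalSpace X] {d : ℕ} (θ : C(X, BO d)) (M : Set E) :
    Type _ :=
  BundleMap θ M (fun x => (⊤ : Submodule ℝ ℝ).prod (tangentSpace M (x : E)))

/-- Smoothness of a map on an arbitrary subset: it extends locally to a smooth map on an
open subset of the ambient space. -/
def SmoothOnSubset (f : E → F) (A : Set E) : Prop :=
  ∀ x ∈ A, ∃ (U : Set E) (g : E → F), IsOpen U ∧ x ∈ U ∧ ContDiffOn ℝ ∞ g U ∧ EqOn f g (A ∩ U)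

/-- Two subsets of normed spaces (for instance submanifolds, possibly with boundary) are
diffeomorphic: there are mutually inverse smooth bijections between them. -/
def Diffeomorphic (A : Set E) (B : Set F) : Prop :=
  ∃ (f : E → F) (g : F → E), MapsTo f A B ∧ MapsTo g B A ∧
    (∀ x ∈ A, g (f x) = x) ∧ (∀ y ∈ B, f (g y) = y) ∧
    SmoothOnSubset f A ∧ SmoothOnSubset g B

end Submanifolds

/-! ### The cobordism category `C_θ` for `d = 2` -/

section Category

variable {X : Type*} [TopologicalSpace X]

/-- Objects of `C_θ`: closed subsets `M` of some `ℝⁿ` which are smooth `1`-manifolds without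
boundary contained in the cube `(-1,1)ⁿ` (so `M` is compact), with a
bundle map `ε¹ ⊕ TM → θ^*γ`. -/
structure Obj (θ : C(X, BO 2)) where
  carrier : Set Ell2
  isSubmanifold : IsSubmanifold 1 carrier
  isClosed : IsClosed carrier
  exists_subset : ∃ n, carrier ⊆ stdSubspace n
  mem_cube : ∀ x ∈ carrier, ∀ i, x i ∈ Ioo (-1 : ℝ) 1
  structureMap : ThetaStructureEps θ carrier

variable {θ : C(X, BO 2)}

/-- The `θ`-manifold `W ⊆ ℝ × ℝ^∞` (with structure `l`) agrees with the cylinder `ℝ × M` over the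
object `c = (M, ℓ)` on the part where the first coordinate lies in `S`. The cylinder has tangent
space `ℝ ⊕ T_x M` at `(s, x)`, and its `θ`-structure is `T(ℝ × M) → ε¹ ⊕ TM → θ^*γ`. -/
def AgreesWithCylinder {W : Set (ℝ × Ell2)} (l : ThetaStructure θ W) (c : Obj θ) (S : Set ℝ) :
    Prop :=
  (∀ p : ℝ × Ell2, p.1 ∈ S → (p ∈ W ↔ p.2 ∈ c.carrier)) ∧
  ∀ (p : ℝ × Ell2) (hW : p ∈ W) (hc : p.2 ∈ c.carrier), p.1 ∈ S →
    l.base ⟨p, hW⟩ = c.structureMap.base ⟨p.2, hc⟩ ∧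
    ∀ (v : ℝ × Ell2) (hv : v ∈ tangentSpace W p)
      (hv' : v ∈ (⊤ : Submodule ℝ ℝ).prod (tangentSpace c.carrier p.2)),
      (l.fibre ⟨p, hW⟩ ⟨v, hv⟩ : Ell2) = c.structureMap.fibre ⟨p.2, hc⟩ ⟨v, hv'⟩

/-- Non-identity morphisms `c₀ → c₁` of `C_θ`: pairs `(t, W)` with `t > 0` and `W ⊆ ℝ × (-1,1)ⁿ` a
closed subset of `ℝ × ℝⁿ`, for some `n`, which is a smooth surface without boundary, with a
`θ`-structure, and which agrees with the cylinder over `c₀` on `(-∞, ε)` and with the cylinder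
over `c₁` on `(t - ε, ∞)`, for some `ε > 0`. -/
structure Cob (c₀ c₁ : Obj θ) where
  length : ℝ
  length_pos : 0 < length
  carrier : Set (ℝ × Ell2)
  isSubmanifold : IsSubmanifold 2 carrier
  isClosed : IsClosed carrier
  exists_subset : ∃ n, ∀ p ∈ carrier, p.2 ∈ stdSubspace n
  mem_cube : ∀ p ∈ carrier, ∀ i, p.2 i ∈ Ioo (-1 : ℝ) 1
  structureMap : ThetaStructure θ carrier
  exists_collar : ∃ ε > 0, AgreesWithCylinder structureMap c₀ (Iio ε) ∧
    AgreesWithCylinder structureMap c₁ (Ioi (length - ε))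

/-- The underlying compact cobordism `W ∩ ([0,t] × ℝ^∞)` of a morphism `(t, W)`; the rest of `W`
consists of the two half-infinite cylinders over source and target. -/
def Cob.underlying {c₀ c₁ : Obj θ} (w : Cob c₀ c₁) : Set (ℝ × Ell2) :=
  {p ∈ w.carrier | p.1 ∈ Icc 0 w.length}

/-- All morphisms of `C_θ`: identities and the non-identity morphisms above. -/
inductive Hom : Obj θ → Obj θ → Type _
  | id (c : Obj θ) : Hom c c
  | cob {c₀ c₁ : Obj θ} (w : Cob c₀ c₁) : Hom c₀ c₁

/-- Two objects are linked by a zig-zag of morphisms: a finite chain of morphisms, each of which may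
point in either direction. -/
def Zigzag (c₀ c₁ : Obj θ) : Prop :=
  Relation.ReflTransGen (fun a b : Obj θ => Nonempty (Hom a b) ∨ Nonempty (Hom b a)) c₀ c₁

end Category

end CobCat

end

noncomputable section

namespace CobCat

/-! ### Two-frames of the pulled back canonical bundle -/

section Frames

variable {X : Type*} [TopologicalSpace X] {θ : C(X, BO 2)}

/-! Mirroring `W` at `s ↦ T - s` produces the right manifold for a reverse, but composing the
structure with the differential `D` of the mirror reverses the direction `∂ = (1, 0)` on the
collars, where the cylinder structure is prescribed. So the structure on `W` has to be altered
first, to one that is already reflected in `∂` near both ends; the two reflections then cancel.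

To alter it, extend `∂` from the collars to a tangent field `v` with countably many zeros and
precompose the structure with the reflection in `v`. This makes sense wherever `v ≠ 0`. In a local
frame the reflection depends on `v` through the loop `w ↦ frameRefl f w` for `w` in the punctured
plane, so the obstruction at a zero is to extend this loop of frames over the origin. Once it
extends, it is enough to substitute the coordinates of a large multiple of `v`; neither
nondegeneracy nor the index of the zero plays a role.

The sphere supplies the extension. Reflections of `ℝ³` in vectors `ν w` move the north pole over
`S²` and carry the two horizontal unit vectors to a tangent frame there. When `ν w` is horizontal
the pole is fixed and the frame is reflected within its plane. Thus a `θ`-structure on `S²` fills in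
one reflection loop (`exists_reflLoopNull_of_sphere`), and path connectedness of `X` transports the
filling to every frame (`ReflLoopNull.change_base`).

The field comes from Sard's theorem (`IsSubmanifold.exists_collared_field`), the alteration is
`IsBundleData.exists_reflect`, and the mirror argument is `Cob.exists_reverse`. A zig-zag then
becomes a directed chain by reversing some arrows, and the chain is composed by gluing
(`Cob.nonempty_comp`). -/

/-- The set of pairs of linearly independent vectors in a fibre of `θ^*γ`. -/
def frameSet (θ : C(X, BO 2)) : Set (X × Ell2 × Ell2) :=
  {f | f.2.1 ∈ (θ f.1).1 ∧ f.2.2 ∈ (θ f.1).1 ∧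
    ∀ a b : ℝ, a • f.2.1 + b • f.2.2 = 0 → a = 0 ∧ b = 0}

/-- Change of frame by the matrix with columns `(a, b)` and `(c, d)`. -/
def frameMul (f : X × Ell2 × Ell2) (a b c d : ℝ) : X × Ell2 × Ell2 :=
  (f.1, a • f.2.1 + b • f.2.2, c • f.2.1 + d • f.2.2)

/-- Change of frame by the reflection `1 - 2 w wᵀ / |w|²` of the plane. -/
def frameRefl (f : X × Ell2 × Ell2) (w : ℝ × ℝ) : X × Ell2 × Ell2 :=
  frameMul f (1 - 2 * w.1 * w.1 / (w.1 ^ 2 + w.2 ^ 2)) (-(2 * w.1 * w.2 / (w.1 ^ 2 + w.2 ^ 2)))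
    (-(2 * w.1 * w.2 / (w.1 ^ 2 + w.2 ^ 2))) (1 - 2 * w.2 * w.2 / (w.1 ^ 2 + w.2 ^ 2))

theorem frameMul_mem {f : X × Ell2 × Ell2} (hf : f ∈ frameSet θ) {a b c d : ℝ}
    (h : a * d - b * c ≠ 0) : frameMul f a b c d ∈ frameSet θ := by
  obtain ⟨h1, h2, h3⟩ := hf
  refine ⟨Submodule.add_mem _ (Submodule.smul_mem _ _ h1) (Submodule.smul_mem _ _ h2),
    Submodule.add_mem _ (Submodule.smul_mem _ _ h1) (Submodule.smul_mem _ _ h2), fun r s hrs => ?_⟩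
  have := h3 (r * a + s * c) (r * b + s * d) (by
    rw [← hrs]; simp only [frameMul]; module)
  obtain ⟨e1, e2⟩ := this
  constructor
  · have : r * (a * d - b * c) = 0 := by linear_combination d * e1 - c * e2
    exact (mul_eq_zero.1 this).resolve_right h
  · have : s * (a * d - b * c) = 0 := by linear_combination a * e2 - b * e1
    exact (mul_eq_zero.1 this).resolve_right h

theorem frameRefl_mem {f : X × Ell2 × Ell2} (hf : f ∈ frameSet θ) {w : ℝ × ℝ}
    (hw : w.1 ^ 2 + w.2 ^ 2 ≠ 0) : frameRefl f w ∈ frameSet θ := by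
  apply frameMul_mem hf
  have : (1 - 2 * w.1 * w.1 / (w.1 ^ 2 + w.2 ^ 2)) * (1 - 2 * w.2 * w.2 / (w.1 ^ 2 + w.2 ^ 2)) -
      (-(2 * w.1 * w.2 / (w.1 ^ 2 + w.2 ^ 2))) * (-(2 * w.1 * w.2 / (w.1 ^ 2 + w.2 ^ 2))) = -1 := by
    field_simp
    ring
  rw [this]
  norm_num

theorem continuousOn_frameRefl {Y : Type*} [TopologicalSpace Y] {s : Set Y}
    {f : Y → X × Ell2 × Ell2} {w : Y → ℝ × ℝ} (hf : ContinuousOn f s) (hw : ContinuousOn w s)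
    (h0 : ∀ y ∈ s, (w y).1 ^ 2 + (w y).2 ^ 2 ≠ 0) :
    ContinuousOn (fun y => frameRefl (f y) (w y)) s := by
  unfold frameRefl frameMul
  have h1 := hf.fst
  have h2 := hf.snd.fst
  have h3 := hf.snd.snd
  have h4 := hw.fst
  have h5 := hw.snd
  have k1 : ContinuousOn (fun y => 1 - 2 * (w y).1 * (w y).1 / ((w y).1 ^ 2 + (w y).2 ^ 2)) s := by
    fun_prop (disch := assumption)
  have k2 : ContinuousOn (fun y => -(2 * (w y).1 * (w y).2 / ((w y).1 ^ 2 + (w y).2 ^ 2))) s := by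
    fun_prop (disch := assumption)
  have k3 : ContinuousOn (fun y => 1 - 2 * (w y).2 * (w y).2 / ((w y).1 ^ 2 + (w y).2 ^ 2)) s := by
    fun_prop (disch := assumption)
  exact h1.prodMk (((k1.smul h2).add (k2.smul h3)).prodMk ((k2.smul h2).add (k3.smul h3)))

/-- The loop of frames obtained from `f` by the reflections of the plane is null-homotopic: it
extends to a family of frames parametrised by the whole plane. -/
def ReflLoopNull (θ : C(X, BO 2)) (f : X × Ell2 × Ell2) : Prop :=
  ∃ (Φ : ℝ × ℝ → X × Ell2 × Ell2) (r : ℝ), 0 < r ∧ Continuous Φ ∧ (∀ w, Φ w ∈ frameSet θ) ∧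
    ∀ w, r ≤ w.1 ^ 2 + w.2 ^ 2 → Φ w = frameRefl f w

/-- If a family `F` of frames, parametrised by `Y × [0, 1]`, starts at a constant frame with
null-homotopic reflection loop, then there is a continuous family of null-homotopies for its end. -/
theorem ReflLoopNull.extend {f : X × Ell2 × Ell2} (h : ReflLoopNull θ f)
    {Y : Type*} [TopologicalSpace Y] {s : Set Y} {F : Y × ℝ → X × Ell2 × Ell2}
    (hF : ContinuousOn F (s ×ˢ Icc 0 1)) (hmem : ∀ z ∈ s ×ˢ Icc (0 : ℝ) 1, F z ∈ frameSet θ)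
    (h0 : ∀ y ∈ s, F (y, 0) = f) :
    ∃ (G : Y × (ℝ × ℝ) → X × Ell2 × Ell2) (r : ℝ), 0 < r ∧ ContinuousOn G (s ×ˢ univ) ∧
      (∀ z ∈ s ×ˢ univ, G z ∈ frameSet θ) ∧
      ∀ y ∈ s, ∀ w : ℝ × ℝ, r ≤ w.1 ^ 2 + w.2 ^ 2 → G (y, w) = frameRefl (F (y, 1)) w := by
  obtain ⟨Φ, r, hr, hΦ, hΦm, hΦr⟩ := h
  classical
  let n : Y × (ℝ × ℝ) → ℝ := fun z => z.2.1 ^ 2 + z.2.2 ^ 2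
  have hn : Continuous n := by fun_prop
  -- The filling `Φ` of the initial frame occupies the disc `|w|² ≤ r`. On the annulus up to `r + 1`
  -- the time `τ` runs from 0 to 1 and the loop is dragged along `F`; beyond it only the end of `F`
  -- is seen.
  let τ : Y × (ℝ × ℝ) → ℝ := fun z => max 0 (min 1 (n z - r))
  have hτ : Continuous τ := by fun_prop
  have hτI : ∀ z, τ z ∈ Icc (0 : ℝ) 1 := fun z => ⟨le_max_left _ _, by simp [τ]⟩
  refine ⟨fun z => if n z ≤ r then Φ z.2 else frameRefl (F (z.1, τ z)) z.2, r + 1, by linarith,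
    ?_, ?_, ?_⟩
  · apply ContinuousOn.if'
    · rintro z ⟨hz, hz'⟩
      have hzr : n z = r := by
        have := frontier_le_subset_eq hn continuous_const hz'
        simpa using this
      have : Φ z.2 = frameRefl (F (z.1, τ z)) z.2 := by
        rw [hΦr z.2 hzr.ge]
        have : τ z = 0 := by simp [τ, hzr]
        rw [this, h0 _ hz.1]
      rw [← this, ite_self]
      have hc : Continuous fun z : Y × (ℝ × ℝ) => Φ z.2 := hΦ.comp continuous_snd
      exact hc.continuousAt.continuousWithinAt.tendsto
    · rintro z ⟨hz, hz'⟩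
      have hzr : n z = r := by
        have := frontier_le_subset_eq hn continuous_const hz'
        simpa using this
      have : Φ z.2 = frameRefl (F (z.1, τ z)) z.2 := by
        rw [hΦr z.2 hzr.ge]
        have : τ z = 0 := by simp [τ, hzr]
        rw [this, h0 _ hz.1]
      simp only [hzr, le_refl, if_true]
      rw [this]
      have hc : ContinuousOn (fun z : Y × (ℝ × ℝ) => frameRefl (F (z.1, τ z)) z.2)
          ((s ×ˢ univ) ∩ {z | 0 < n z}) := by
        apply continuousOn_frameRefl
        · exact hF.comp (by fun_prop) fun z hz => ⟨hz.1.1, hτI z⟩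
        · fun_prop
        · exact fun z hz => ne_of_gt hz.2
      have := (hc z ⟨hz, by simp [hzr, hr]⟩).tendsto
      refine this.mono_left (nhdsWithin_mono _ ?_)
      rintro z ⟨h1, h2⟩
      exact ⟨h1, hr.trans (not_le.1 h2)⟩
    · exact (hΦ.comp continuous_snd).continuousOn
    · apply continuousOn_frameRefl
      · exact hF.comp (by fun_prop) fun z hz => ⟨hz.1.1, hτI z⟩
      · fun_prop
      · exact fun z hz => ne_of_gt (hr.trans (not_le.1 hz.2))
  · intro z hz
    dsimp only
    split_ifs with hzr
    · exact hΦm _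
    · exact frameRefl_mem (hmem _ ⟨hz.1, hτI z⟩) (ne_of_gt (hr.trans (not_le.1 hzr)))
  · intro y hy w hw
    have h1 : ¬ n (y, w) ≤ r := by simp only [n]; linarith
    have h2 : τ (y, w) = 1 := by
      simp only [τ, n]
      rw [min_eq_left (by linarith)]
      simp
    simp only [h1, if_false, h2]

theorem ReflLoopNull.of_path {γ : ℝ → X × Ell2 × Ell2} (h : ReflLoopNull θ (γ 0))
    (hγ : ContinuousOn γ (Icc 0 1)) (hmem : ∀ s ∈ Icc (0 : ℝ) 1, γ s ∈ frameSet θ) :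
    ReflLoopNull θ (γ 1) := by
  obtain ⟨G, r, hr, hG, hGm, hGr⟩ := h.extend (Y := Unit) (s := univ) (F := fun z => γ z.2)
    (hγ.comp continuous_snd.continuousOn fun z hz => hz.2) (fun z hz => hmem _ hz.2)
    (fun _ _ => rfl)
  refine ⟨fun w => G ((), w), r, hr, ?_, fun w => hGm _ ⟨trivial, trivial⟩, fun w hw => hGr _ trivial _ hw⟩
  rw [← continuousOn_univ]
  exact hG.comp (by fun_prop) fun w _ => ⟨trivial, trivial⟩

/-- For orthogonal `Q`, the reflection in `w` followed by conjugation satisfies `Q R_w = R_{Qw} Q`.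
Hence precomposing the filling with `w ↦ Q w` and multiplying its frames by `Q` gives a filling for
the new frame. Both components of the orthogonal group are covered. -/
theorem ReflLoopNull.mul_orthogonal {f : X × Ell2 × Ell2} (h : ReflLoopNull θ f) {a b c d : ℝ}
    (h1 : a ^ 2 + b ^ 2 = 1) (h2 : c ^ 2 + d ^ 2 = 1) (h3 : a * c + b * d = 0) :
    ReflLoopNull θ (frameMul f a b c d) := by
  obtain ⟨Φ, r, hr, hΦ, hΦm, hΦr⟩ := h
  have hdet : (a * d - b * c) ^ 2 = 1 := by
    linear_combination h1 * (c ^ 2 + d ^ 2) + h2 - (a * c + b * d) * h3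
  have hdet' : a * d - b * c ≠ 0 := by
    intro h
    rw [h] at hdet
    norm_num at hdet
  refine ⟨fun w => frameMul (Φ (a * w.1 + c * w.2, b * w.1 + d * w.2)) a b c d, r, hr, ?_,
    fun w => frameMul_mem (hΦm _) hdet', fun w hw => ?_⟩
  · unfold frameMul
    fun_prop
  · have hn : (a * w.1 + c * w.2) ^ 2 + (b * w.1 + d * w.2) ^ 2 = w.1 ^ 2 + w.2 ^ 2 := by
      linear_combination w.1 ^ 2 * h1 + w.2 ^ 2 * h2 + 2 * w.1 * w.2 * h3
    have hn0 : w.1 ^ 2 + w.2 ^ 2 ≠ 0 := by linarith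
    dsimp only
    rw [hΦr _ (by dsimp only; rw [hn]; exact hw)]
    simp only [frameRefl, hn]
    set m := w.1 ^ 2 + w.2 ^ 2 with hm
    simp only [frameMul, Prod.mk.injEq, true_and]
    constructor
    · match_scalars
      · field_simp
        linear_combination (-2 * w.1 * (a * w.1 + c * w.2)) * h1 - (2 * w.2 * (a * w.1 + c * w.2)) * h3
      · field_simp
        linear_combination (-2 * w.1 * (b * w.1 + d * w.2)) * h1 - (2 * w.2 * (b * w.1 + d * w.2)) * h3
    · match_scalars
      · field_simp
        linear_combination (-2 * w.1 * (a * w.1 + c * w.2)) * h3 - (2 * w.2 * (a * w.1 + c * w.2)) * h2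
      · field_simp
        linear_combination (-2 * w.1 * (b * w.1 + d * w.2)) * h3 - (2 * w.2 * (b * w.1 + d * w.2)) * h2

theorem exists_frameMul_eq {f f' : X × Ell2 × Ell2} (hf : f ∈ frameSet θ) (hf' : f' ∈ frameSet θ)
    (hb : f'.1 = f.1) : ∃ a b c d : ℝ, a * d - b * c ≠ 0 ∧ f' = frameMul f a b c d := by
  obtain ⟨x, y, z⟩ := f
  obtain ⟨x', y', z'⟩ := f'
  obtain rfl : x' = x := hb
  obtain ⟨hy, hz, hi⟩ := hf
  obtain ⟨hy', hz', hi'⟩ := hf'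
  dsimp only at *
  have hspan : ∀ u ∈ (θ x').1, ∃ a b : ℝ, u = a • y + b • z := by
    have hfr : Module.finrank ℝ (θ x').1 = 2 := (θ x').2.1
    have hli : LinearIndependent ℝ ![(⟨y, hy⟩ : (θ x').1), ⟨z, hz⟩] := by
      rw [LinearIndependent.pair_iff]
      intro s t hst
      exact hi s t (congrArg Subtype.val hst)
    have : FiniteDimensional ℝ (θ x').1 := Module.finite_of_finrank_eq_succ hfr
    have htop := hli.span_eq_top_of_card_eq_finrank (by simp [hfr])
    intro u hu
    have : (⟨u, hu⟩ : (θ x').1) ∈ Submodule.span ℝ (range ![(⟨y, hy⟩ : (θ x').1), ⟨z, hz⟩]) := by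
      rw [htop]; trivial
    simp only [Matrix.range_cons, Matrix.range_empty, union_empty, singleton_union] at this
    obtain ⟨a, b, hab⟩ := Submodule.mem_span_pair.1 this
    exact ⟨a, b, (congrArg Subtype.val hab).symm⟩
  obtain ⟨a, b, rfl⟩ := hspan _ hy'
  obtain ⟨c, d, rfl⟩ := hspan _ hz'
  refine ⟨a, b, c, d, fun h => ?_, rfl⟩
  have e1 := hi' d (-b) (by
    have : d • (a • y + b • z) + -b • (c • y + d • z) = (a * d - b * c) • y := by module
    rw [this, h, zero_smul])
  have e2 := hi' c (-a) (by
    have : c • (a • y + b • z) + -a • (c • y + d • z) = -((a * d - b * c) • z) := by module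
    rw [this, h, zero_smul, neg_zero])
  have ha : a = 0 := by linarith [e2.2]
  have hb : b = 0 := by linarith [e1.2]
  have := hi' 1 0 (by simp [ha, hb])
  norm_num at this

/-- Gram–Schmidt: a change of frame is `Q T` with `Q` orthogonal, of the same determinant sign, and
`T` upper triangular with positive diagonal. `Q` is handled by conjugation, `T` by a path to the
identity. -/
theorem ReflLoopNull.change_frame {f f' : X × Ell2 × Ell2} (h : ReflLoopNull θ f)
    (hf : f ∈ frameSet θ) (hf' : f' ∈ frameSet θ) (hb : f'.1 = f.1) : ReflLoopNull θ f' := by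
  obtain ⟨a, b, c, d, hdet, rfl⟩ := exists_frameMul_eq hf hf' hb
  have hm : 0 < a ^ 2 + b ^ 2 := by
    rcases eq_or_ne a 0 with rfl | ha
    · have : b ≠ 0 := by rintro rfl; simp at hdet
      positivity
    · positivity
  obtain ⟨m, hm0, hmm⟩ : ∃ m : ℝ, 0 < m ∧ m ^ 2 = a ^ 2 + b ^ 2 :=
    ⟨√(a ^ 2 + b ^ 2), Real.sqrt_pos.2 hm, Real.sq_sqrt hm.le⟩
  obtain ⟨σ, hσ, hσd⟩ : ∃ σ : ℝ, σ ^ 2 = 1 ∧ 0 < σ * (a * d - b * c) := by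
    rcases lt_or_gt_of_ne hdet with h | h
    · exact ⟨-1, by norm_num, by linarith⟩
    · exact ⟨1, by norm_num, by linarith⟩
  have hunit : (a / m) ^ 2 + (b / m) ^ 2 = 1 := by
    field_simp
    exact hmm.symm
  have hq := h.mul_orthogonal (a := a / m) (b := b / m) (c := -(σ * b / m)) (d := σ * a / m)
    hunit (by
      have : (-(σ * b / m)) ^ 2 + (σ * a / m) ^ 2 = σ ^ 2 * ((a / m) ^ 2 + (b / m) ^ 2) := by ring
      rw [this, hσ, hunit, one_mul]) (by ring)
  set q := frameMul f (a / m) (b / m) (-(σ * b / m)) (σ * a / m) with hqd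
  have hqm : q ∈ frameSet θ := by
    apply frameMul_mem hf
    have : a / m * (σ * a / m) - b / m * -(σ * b / m) = σ * ((a / m) ^ 2 + (b / m) ^ 2) := by ring
    rw [this, hunit, mul_one]
    rintro rfl
    norm_num at hσ
  -- The segment from the identity to `T`. The diagonal of `T` consists of `m`, the length of the
  -- first column, and `|det| / m`, so every matrix on the segment is invertible.
  let γ : ℝ → X × Ell2 × Ell2 := fun s => frameMul q (1 - s + s * m) 0
    (s * ((a * c + b * d) / m)) (1 - s + s * (σ * (a * d - b * c) / m))
  have h0 : γ 0 = q := by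
    simp [γ, frameMul]
  have h1 : γ 1 = frameMul f a b c d := by
    simp only [γ, hqd, frameMul, Prod.mk.injEq, true_and]
    constructor
    · match_scalars <;> field_simp <;> ring
    · match_scalars
      · field_simp
        linear_combination (-c) * hmm - b * (a * d - b * c) * hσ
      · field_simp
        linear_combination (-d) * hmm + a * (a * d - b * c) * hσ
  rw [← h1]
  refine ReflLoopNull.of_path (h0 ▸ hq) ?_ ?_
  · apply Continuous.continuousOn
    simp only [γ, frameMul]
    fun_prop
  · intro s hs
    apply frameMul_mem hqm
    have p1 : 0 < 1 - s + s * m := by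
      rcases eq_or_lt_of_le hs.1 with rfl | h
      · norm_num
      · have := mul_pos h hm0
        linarith [hs.2]
    have p2 : 0 < 1 - s + s * (σ * (a * d - b * c) / m) := by
      rcases eq_or_lt_of_le hs.1 with rfl | h
      · norm_num
      · have := mul_pos h (div_pos hσd hm0)
        linarith [hs.2]
    have := mul_pos p1 p2
    simp only [zero_mul, sub_zero]
    exact this.ne'

end Frames

/-! ### Local frames of the canonical bundle, and moving along paths in the base -/

section LocalFrames

theorem isOpen_BO_iff {d : ℕ} {O : Set (BO d)} :
    IsOpen O ↔ ∀ n, IsOpen {v : Frame d n | v.plane ∈ O} := by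
  rw [isOpen_iSup_iff]
  exact forall_congr' fun n => isOpen_coinduced

/-- The canonical bundle over `BO(2)` has local frames. -/
theorem exists_local_frame (P₀ : BO 2) :
    ∃ (O : Set (BO 2)) (σ τ : BO 2 → Ell2), IsOpen O ∧ P₀ ∈ O ∧ ContinuousOn σ O ∧
      ContinuousOn τ O ∧ ∀ P ∈ O, σ P ∈ P.1 ∧ τ P ∈ P.1 ∧
        ∀ a b : ℝ, a • σ P + b • τ P = 0 → a = 0 ∧ b = 0 := by
  classical
  have key : ∀ P : BO 2, ∃ v : Fin 2 → Ell2, (∃ n, ∀ i, v i ∈ stdSubspace n) ∧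
      LinearIndependent ℝ v ∧ Submodule.span ℝ (range v) = P.1 := by
    intro P
    have hP := P.2.1
    have : FiniteDimensional ℝ P.1 := Module.finite_of_finrank_eq_succ hP
    let b := Module.finBasisOfFinrankEq ℝ P.1 hP
    obtain ⟨n, hn⟩ := P.2.2
    refine ⟨fun i => (b i : Ell2), ⟨n, fun i => hn (b i).2⟩, ?_, ?_⟩
    · exact b.linearIndependent.map' P.1.subtype (Submodule.ker_subtype _)
    · have : range (fun i => (b i : Ell2)) = P.1.subtype '' range b := by
        rw [← range_comp]; rfl
      rw [this, Submodule.span_image, b.span_eq, Submodule.map_top, Submodule.range_subtype]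
  obtain ⟨w, -, hwi, hwP⟩ := key P₀
  -- Nonvanishing of `D` says that orthogonal projection to `P₀` is injective on the span of `v`.
  -- Then `s` and `t` are, by Cramer's rule, the basis of that span dual to `w`.
  let D : (Fin 2 → Ell2) → ℝ := fun v =>
    inner ℝ (w 0) (v 0) * inner ℝ (w 1) (v 1) - inner ℝ (w 0) (v 1) * inner ℝ (w 1) (v 0)
  let s : (Fin 2 → Ell2) → Ell2 := fun v =>
    (inner ℝ (w 1) (v 1) / D v) • v 0 - (inner ℝ (w 1) (v 0) / D v) • v 1
  let t : (Fin 2 → Ell2) → Ell2 := fun v =>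
    (inner ℝ (w 0) (v 0) / D v) • v 1 - (inner ℝ (w 0) (v 1) / D v) • v 0
  -- This characterises the dual basis by the plane alone. Since it determines the pair uniquely,
  -- `s` and `t` descend from frames to planes; continuity can be tested on frames because `BO 2`
  -- carries a quotient topology.
  let good : BO 2 → (Ell2 × Ell2) → Prop := fun P z => z.1 ∈ P.1 ∧ z.2 ∈ P.1 ∧
    inner ℝ (w 0) z.1 = (1 : ℝ) ∧ inner ℝ (w 1) z.1 = (0 : ℝ) ∧
    inner ℝ (w 0) z.2 = (0 : ℝ) ∧ inner ℝ (w 1) z.2 = (1 : ℝ)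
  have good_unique : ∀ P z z', good P z → good P z' → z = z' := by
    intro P z z' hz hz'
    have hP := P.2.1
    have : FiniteDimensional ℝ P.1 := Module.finite_of_finrank_eq_succ hP
    obtain ⟨h1, h2, h3, h4, h5, h6⟩ := hz
    have hli : LinearIndependent ℝ ![(⟨z.1, h1⟩ : P.1), ⟨z.2, h2⟩] := by
      rw [LinearIndependent.pair_iff]
      intro a b hab
      have hab' : a • z.1 + b • z.2 = 0 := congrArg Subtype.val hab
      have e1 := congrArg (fun u => inner ℝ (w 0) u) hab'
      have e2 := congrArg (fun u => inner ℝ (w 1) u) hab'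
      simp only [inner_add_right, inner_smul_right, h3, h4, h5, h6, inner_zero_right] at e1 e2
      constructor <;> linarith
    have htop := hli.span_eq_top_of_card_eq_finrank (by simp [hP])
    have hrep : ∀ u ∈ P.1, u = (inner ℝ (w 0) u : ℝ) • z.1 + (inner ℝ (w 1) u : ℝ) • z.2 := by
      intro u hu
      have : (⟨u, hu⟩ : P.1) ∈ Submodule.span ℝ (range ![(⟨z.1, h1⟩ : P.1), ⟨z.2, h2⟩]) := by
        rw [htop]; trivial
      simp only [Matrix.range_cons, Matrix.range_empty, union_empty, singleton_union] at this
      obtain ⟨a, b, hab⟩ := Submodule.mem_span_pair.1 this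
      have hab' : a • z.1 + b • z.2 = u := congrArg Subtype.val hab
      rw [← hab']
      simp only [inner_add_right, inner_smul_right, h3, h4, h5, h6]
      simp
    obtain ⟨k1, k2, k3, k4, k5, k6⟩ := hz'
    have e1 := hrep _ k1
    have e2 := hrep _ k2
    rw [k3, k4] at e1
    rw [k5, k6] at e2
    simp only [one_smul, zero_smul, add_zero, zero_add] at e1 e2
    exact Prod.ext e1.symm e2.symm
  have good_of_D : ∀ {n} (v : Frame 2 n), D v.1 ≠ 0 → good v.plane (s v.1, t v.1) := by
    intro n v hv
    have m : ∀ i, v.1 i ∈ v.plane.1 := fun i => Submodule.subset_span ⟨i, rfl⟩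
    refine ⟨Submodule.sub_mem _ (Submodule.smul_mem _ _ (m 0)) (Submodule.smul_mem _ _ (m 1)),
      Submodule.sub_mem _ (Submodule.smul_mem _ _ (m 1)) (Submodule.smul_mem _ _ (m 0)), ?_⟩
    simp only [s, t, inner_sub_right, inner_smul_right]
    refine ⟨?_, ?_, ?_, ?_⟩ <;> field_simp <;> simp only [D] <;> ring
  have D_of_good : ∀ {n} (v : Frame 2 n) z, good v.plane z → D v.1 ≠ 0 := by
    intro n v z hz hD
    have hsp : v.plane.1 = Submodule.span ℝ {v.1 0, v.1 1} := by
      have : range v.1 = {v.1 0, v.1 1} := by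
        ext u
        simp [Fin.exists_fin_two, eq_comm]
      rw [← this]; rfl
    obtain ⟨h1, h2, h3, h4, h5, h6⟩ := hz
    rw [hsp] at h1 h2
    obtain ⟨a, b, hab⟩ := Submodule.mem_span_pair.1 h1
    obtain ⟨c, d, hcd⟩ := Submodule.mem_span_pair.1 h2
    rw [← hab] at h3 h4
    rw [← hcd] at h5 h6
    simp only [inner_add_right, inner_smul_right] at h3 h4 h5 h6
    have : (1 : ℝ) = (a * d - b * c) * D v.1 := by
      simp only [D]
      set p := (inner ℝ (w 0) (v.1 0) : ℝ)
      set q := (inner ℝ (w 0) (v.1 1) : ℝ)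
      set r := (inner ℝ (w 1) (v.1 0) : ℝ)
      set u := (inner ℝ (w 1) (v.1 1) : ℝ)
      have : (a * d - b * c) * (p * u - q * r) =
        (a * p + b * q) * (c * r + d * u) - (a * r + b * u) * (c * p + d * q) := by ring
      rw [this, h3, h4, h5, h6]; ring
    rw [hD] at this
    norm_num at this
  let O : Set (BO 2) := {P | ∃ z, good P z}
  have hOfr : ∀ {n} (v : Frame 2 n), v.plane ∈ O ↔ D v.1 ≠ 0 := fun v =>
    ⟨fun ⟨z, hz⟩ => D_of_good v z hz, fun h => ⟨_, good_of_D v h⟩⟩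
  let S : BO 2 → Ell2 × Ell2 := fun P => if h : P ∈ O then Classical.choose h else 0
  have hS : ∀ P ∈ O, good P (S P) := by
    intro P hP
    simp only [S, hP, dif_pos]
    exact Classical.choose_spec hP
  have hSv : ∀ {n} (v : Frame 2 n), D v.1 ≠ 0 → S v.plane = (s v.1, t v.1) := fun v hv =>
    good_unique _ _ _ (hS _ ((hOfr v).2 hv)) (good_of_D v hv)
  have hDc : Continuous D := by fun_prop
  have hO : IsOpen O := by
    rw [isOpen_BO_iff]
    intro n
    simp only [hOfr]
    exact isOpen_ne.preimage (hDc.comp continuous_subtype_val)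
  have hSc : ContinuousOn S O := by
    rw [continuousOn_open_iff hO]
    intro V hV
    rw [isOpen_BO_iff]
    intro n
    have hst : ContinuousOn (fun v : Frame 2 n => (s v.1, t v.1)) {v | D v.1 ≠ 0} := by
      simp only [s, t]
      have : Continuous fun v : Frame 2 n => D v.1 := hDc.comp continuous_subtype_val
      have c0 : Continuous fun v : Frame 2 n => v.1 0 :=
        (continuous_apply 0).comp continuous_subtype_val
      have c1 : Continuous fun v : Frame 2 n => v.1 1 :=
        (continuous_apply 1).comp continuous_subtype_val
      have i1 : ∀ i j, Continuous fun v : Frame 2 n => (inner ℝ (w i) (v.1 j) : ℝ) :=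
        fun i j => continuous_const.inner ((continuous_apply j).comp continuous_subtype_val)
      have q : ∀ i j, ContinuousOn (fun v : Frame 2 n => (inner ℝ (w i) (v.1 j) : ℝ) / D v.1)
          {v | D v.1 ≠ 0} := fun i j => (i1 i j).continuousOn.div this.continuousOn fun v hv => hv
      exact (((q 1 1).smul c0.continuousOn).sub ((q 1 0).smul c1.continuousOn)).prodMk
        (((q 0 0).smul c1.continuousOn).sub ((q 0 1).smul c0.continuousOn))
    have := hst.isOpen_inter_preimage
      (isOpen_ne.preimage (hDc.comp continuous_subtype_val)) hV
    convert this using 1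
    ext v
    constructor
    · rintro ⟨h1, h2⟩
      have h1' := (hOfr v).1 h1
      refine ⟨h1', ?_⟩
      rw [mem_preimage, hSv v h1'] at h2
      exact h2
    · rintro ⟨h1, h2⟩
      refine ⟨(hOfr v).2 h1, ?_⟩
      rw [mem_preimage, hSv v h1]
      exact h2
  refine ⟨O, fun P => (S P).1, fun P => (S P).2, hO, ?_, hSc.fst, hSc.snd, fun P hP => ?_⟩
  · by_contra hcon
    obtain ⟨v, ⟨n, hvn⟩, hvi, hvP⟩ := key P₀
    have hpl : Frame.plane (⟨w, ⟨by
      intro i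
      have : w i ∈ P₀.1 := hwP ▸ Submodule.subset_span ⟨i, rfl⟩
      exact P₀.2.2.choose_spec this, hwi⟩⟩ : Frame 2 P₀.2.2.choose) = P₀ := Subtype.ext hwP
    rw [← hpl, hOfr, not_not] at hcon
    simp only [D] at hcon
    -- If the Gram determinant of `w` vanished, this combination would have square norm `⟨w 1, w 1⟩`
    -- times that determinant, hence be zero, against independence.
    have hk : (inner ℝ (w 1) (w 1) : ℝ) • w 0 + (-(inner ℝ (w 0) (w 1) : ℝ)) • w 1 = 0 := by
      rw [← inner_self_eq_zero (𝕜 := ℝ)]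
      simp only [inner_add_left, inner_add_right, inner_smul_left, inner_smul_right,
        conj_trivial]
      rw [real_inner_comm (w 0) (w 1)] at hcon ⊢
      linear_combination (inner ℝ (w 1) (w 1) : ℝ) * hcon
    have hw2 : LinearIndependent ℝ ![w 0, w 1] := by
      convert hwi using 1
      ext i
      fin_cases i <;> rfl
    have := (LinearIndependent.pair_iff.1 hw2 _ _ hk).1
    have h0 : w 1 = 0 := inner_self_eq_zero.1 this
    exact hwi.ne_zero 1 h0
  · obtain ⟨h1, h2, h3, h4, h5, h6⟩ := hS P hP
    refine ⟨h1, h2, fun a b hab => ?_⟩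
    have e1 := congrArg (fun u => inner ℝ (w 0) u) hab
    have e2 := congrArg (fun u => inner ℝ (w 1) u) hab
    simp only [inner_add_right, inner_smul_right, h3, h4, h5, h6, inner_zero_right] at e1 e2
    constructor <;> linarith

variable {X : Type*} [TopologicalSpace X] {θ : C(X, BO 2)}

/-- Along a path in `X`, the property that all frames over the point have null-homotopic reflection
loops is locally constant: over a short segment a local frame of the canonical bundle gives a path
of frames, and within a fibre the choice of frame is irrelevant. -/
theorem ReflLoopNull.change_base [PathConnectedSpace X] {f f' : X × Ell2 × Ell2}
    (h : ReflLoopNull θ f) (hf : f ∈ frameSet θ) (hf' : f' ∈ frameSet θ) : ReflLoopNull θ f' := by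
  let p := (PathConnectedSpace.joined f.1 f'.1).somePath
  let A : X → Prop := fun x => ∀ g ∈ frameSet θ, g.1 = x → ReflLoopNull θ g
  have hA : ∀ g ∈ frameSet θ, ReflLoopNull θ g → A g.1 := fun g hg hN g' hg' hb =>
    hN.change_frame hg hg' hb
  have step : ∀ (γ : ℝ → X), Continuous γ → ∀ (O : Set (BO 2)) (σ τ : BO 2 → Ell2),
      ContinuousOn σ O → ContinuousOn τ O → (∀ P ∈ O, σ P ∈ P.1 ∧ τ P ∈ P.1 ∧
        ∀ a b : ℝ, a • σ P + b • τ P = 0 → a = 0 ∧ b = 0) →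
      (∀ s ∈ Icc (0 : ℝ) 1, θ (γ s) ∈ O) → A (γ 0) → A (γ 1) := by
    intro γ hγ O σ τ hσ hτ hO hγO hA0
    let δ : ℝ → X × Ell2 × Ell2 := fun s => (γ s, σ (θ (γ s)), τ (θ (γ s)))
    have hδm : ∀ s ∈ Icc (0 : ℝ) 1, δ s ∈ frameSet θ := fun s hs => hO _ (hγO s hs)
    have hc : ContinuousOn (fun s => θ (γ s)) (Icc 0 1) :=
      (θ.continuous.comp hγ).continuousOn
    have hδ : ContinuousOn δ (Icc 0 1) :=
      hγ.continuousOn.prodMk ((hσ.comp hc hγO).prodMk (hτ.comp hc hγO))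
    have : ReflLoopNull θ (δ 1) :=
      ReflLoopNull.of_path (hA0 _ (hδm 0 (by simp)) rfl) hδ hδm
    exact hA (δ 1) (hδm 1 (by simp)) this
  have hloc : IsLocallyConstant fun s : ℝ => A (p.extend s) := by
    rw [IsLocallyConstant.iff_eventually_eq]
    intro s₀
    obtain ⟨O, σ, τ, hOo, hs₀, hσ, hτ, hO⟩ := exists_local_frame (θ (p.extend s₀))
    have hcont : Continuous fun s => θ (p.extend s) := θ.continuous.comp p.continuous_extend
    obtain ⟨r, hr, hball⟩ := Metric.isOpen_iff.1 (hOo.preimage hcont) s₀ hs₀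
    filter_upwards [Metric.ball_mem_nhds s₀ hr] with s hs
    have hseg : ∀ u v : ℝ, u ∈ Metric.ball s₀ r → v ∈ Metric.ball s₀ r →
        A (p.extend u) → A (p.extend v) := by
      intro u v hu hv hAu
      have := step (fun x => p.extend (u + x * (v - u))) (by fun_prop) O σ τ hσ hτ hO
        (fun x hx => hball (by
          have := (convex_ball s₀ r) hu hv (sub_nonneg.2 hx.2) hx.1 (by ring)
          simp only [smul_eq_mul] at this
          convert this using 1
          ring)) (by simpa using hAu)
      simpa using this
    exact propext ⟨hseg _ _ hs (Metric.mem_ball_self hr), hseg _ _ (Metric.mem_ball_self hr) hs⟩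
  have := hloc.apply_eq_of_preconnectedSpace 0 1
  simp only [Path.extend_zero, Path.extend_one] at this
  exact this.mp (hA f hf h) f' hf' rfl

end LocalFrames

/-! ### Filling a reflection loop by means of the two-sphere -/

section Sphere

variable {X : Type*} [TopologicalSpace X] {θ : C(X, BO 2)}

/-- If `M` contains a curve through `x` with velocity `u`, then `u` is tangent to `M`. -/
theorem mem_tangentSpace_of_hasDerivAt {E : Type*} [NormedAddCommGroup E] [NormedSpace ℝ E]
    {M : Set E} {x u : E} {c : ℝ → E} (hc : HasDerivAt c u 0) (h0 : c 0 = x)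
    (hM : ∀ᶠ s in 𝓝 0, c s ∈ M) : u ∈ tangentSpace M x := by
  apply Submodule.subset_span
  have hs : HasFDerivWithinAt c (ContinuousLinearMap.toSpanSingleton ℝ u) (c ⁻¹' M) 0 :=
    hc.hasFDerivAt.hasFDerivWithinAt
  have h1 : (1 : ℝ) ∈ tangentConeAt ℝ (c ⁻¹' M) 0 := by
    have hM' : c ⁻¹' M ∈ 𝓝 0 := hM
    rw [tangentConeAt_of_mem_nhds hM']
    trivial
  have := hs.mapsTo_tangent_cone h1
  rw [h0] at this
  have h2 := tangentConeAt_mono (𝕜 := ℝ) (x := x) (image_preimage_subset c M) this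
  simpa using h2

theorem mem_tangentSpace_sphere {E : Type*} [NormedAddCommGroup E] [InnerProductSpace ℝ E]
    {x u : E} (hx : ‖x‖ = 1) (hu : ‖u‖ = 1) (hxu : inner ℝ x u = (0 : ℝ)) :
    u ∈ tangentSpace (Metric.sphere (0 : E) 1) x := by
  refine mem_tangentSpace_of_hasDerivAt (c := fun s => Real.cos s • x + Real.sin s • u) ?_
    (by simp) (Filter.Eventually.of_forall fun s => ?_)
  · have := ((Real.hasDerivAt_cos 0).smul_const x).fun_add ((Real.hasDerivAt_sin 0).smul_const u)
    simpa using this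
  · rw [mem_sphere_zero_iff_norm, ← sq_eq_sq₀ (norm_nonneg _) zero_le_one,
      ← real_inner_self_eq_norm_sq]
    simp only [inner_add_left, inner_add_right, inner_smul_left, inner_smul_right,
      real_inner_self_eq_norm_sq, hx, hu, hxu, real_inner_comm x u, conj_trivial]
    have := Real.cos_sq_add_sin_sq s
    linear_combination this

/-- The reflection `H w` of `ℝ³` in `ν w` is orthogonal, so it takes `e 2` to a point of the sphere
and `e 0`, `e 1` to an orthonormal tangent frame there. The structure `m` maps these tangent frames
to frames of `θ^*γ`, parametrised continuously by the whole plane. -/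
theorem exists_reflLoopNull_of_sphere
    (m : ThetaStructure θ (Metric.sphere (0 : EuclideanSpace ℝ (Fin 3)) 1)) :
    ∃ f ∈ frameSet θ, ReflLoopNull θ f := by
  -- The third coordinate keeps `ν w` nonzero at the origin and vanishes for `|w| ≥ 1`, where `H w`
  -- fixes `e 2` and restricts to the planar reflection in `w`.
  let ν : ℝ × ℝ → EuclideanSpace ℝ (Fin 3) := fun w => !₂[w.1, w.2, max 0 (1 - (w.1 ^ 2 + w.2 ^ 2))]
  let n : ℝ × ℝ → ℝ := fun w => w.1 ^ 2 + w.2 ^ 2 + max 0 (1 - (w.1 ^ 2 + w.2 ^ 2)) ^ 2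
  have hn : ∀ w, n w ≠ 0 := by
    intro w hw
    simp only [n] at hw
    have h1 : w.1 ^ 2 + w.2 ^ 2 = 0 := by
      nlinarith [sq_nonneg w.1, sq_nonneg w.2, sq_nonneg (max 0 (1 - (w.1 ^ 2 + w.2 ^ 2)))]
    rw [h1] at hw
    norm_num at hw
  have hνn : ∀ w, inner ℝ (ν w) (ν w) = n w := by
    intro w
    rw [PiLp.inner_apply]
    simp [ν, n, Fin.sum_univ_three]
  have hνc : Continuous ν := by
    simp only [ν]
    fun_prop
  have hnc : Continuous n := by simp only [n]; fun_prop
  let H : ℝ × ℝ → EuclideanSpace ℝ (Fin 3) → EuclideanSpace ℝ (Fin 3) := fun w u =>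
    u - (2 * inner ℝ (ν w) u / n w) • ν w
  have hH : ∀ w u u', inner ℝ (H w u) (H w u') = (inner ℝ u u' : ℝ) := by
    intro w u u'
    simp only [H, inner_sub_left, inner_sub_right, inner_smul_left, inner_smul_right, hνn,
      conj_trivial, real_inner_comm (ν w) u]
    have := hn w
    field_simp
    ring
  have hHc : ∀ u, Continuous fun w => H w u := by
    intro u
    simp only [H]
    exact continuous_const.sub (((by fun_prop : Continuous fun w => 2 * inner ℝ (ν w) u).div hnc hn).smul hνc)
  let e : Fin 3 → EuclideanSpace ℝ (Fin 3) := fun i => EuclideanSpace.single i 1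
  have hee : ∀ i j, (inner ℝ (e i) (e j) : ℝ) = if i = j then 1 else 0 := by
    intro i j
    simp [e, EuclideanSpace.inner_single_left]
  have hnorm : ∀ w i, ‖H w (e i)‖ = 1 := by
    intro w i
    rw [← sq_eq_sq₀ (norm_nonneg _) zero_le_one, ← real_inner_self_eq_norm_sq, hH]
    simp [e]
  have hsph : ∀ w, H w (e 2) ∈ Metric.sphere (0 : EuclideanSpace ℝ (Fin 3)) 1 := fun w => by
    simpa using hnorm w 2
  have ht : ∀ w, ∀ i, i ≠ 2 → H w (e i) ∈ tangentSpace (Metric.sphere (0 : EuclideanSpace ℝ (Fin 3)) 1) (H w (e 2)) := by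
    intro w i hi
    refine mem_tangentSpace_sphere (hnorm w 2) (hnorm w i) ?_
    rw [hH, hee, if_neg hi.symm]
  have ht0 := fun w => ht w 0 (by decide)
  have ht1 := fun w => ht w 1 (by decide)
  let Φ : ℝ × ℝ → X × Ell2 × Ell2 := fun w => (m.base ⟨_, hsph w⟩,
    (m.fibre ⟨_, hsph w⟩ ⟨_, ht0 w⟩ : Ell2), (m.fibre ⟨_, hsph w⟩ ⟨_, ht1 w⟩ : Ell2))
  have hind : ∀ w (a b : ℝ), a • H w (e 0) + b • H w (e 1) = 0 → a = 0 ∧ b = 0 := by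
    intro w a b hab
    have e1 := congrArg (fun u => inner ℝ (H w (e 0)) u) hab
    have e2 := congrArg (fun u => inner ℝ (H w (e 1)) u) hab
    simp only [inner_add_right, inner_smul_right, hH, inner_zero_right] at e1 e2
    simp only [hee] at e1 e2
    norm_num at e1 e2
    exact ⟨e1, e2⟩
  have hΦm : ∀ w, Φ w ∈ frameSet θ := by
    intro w
    refine ⟨Subtype.prop _, Subtype.prop _, fun a b hab => ?_⟩
    apply hind w
    have : m.fibre ⟨_, hsph w⟩ (a • ⟨_, ht0 w⟩ + b • ⟨_, ht1 w⟩) = 0 := by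
      apply Subtype.ext
      rw [map_add, map_smul, map_smul]
      exact hab
    have := (m.fibre ⟨_, hsph w⟩).map_eq_zero_iff.1 this
    exact congrArg Subtype.val this
  have hΦc : Continuous Φ := by
    have hcomp : ∀ i (hi : ∀ w, H w (e i) ∈ tangentSpace (Metric.sphere (0 : EuclideanSpace ℝ (Fin 3)) 1) (H w (e 2))),
        Continuous fun w => (m.base ⟨_, hsph w⟩, (m.fibre ⟨_, hsph w⟩ ⟨_, hi w⟩ : Ell2)) := by
      intro i hi
      exact continuous_subtype_val.comp (m.continuous_total.comp
        (f := fun w => ⟨(⟨H w (e 2), hsph w⟩, H w (e i)), hi w⟩)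
        (((((hHc _).subtype_mk _).prodMk (hHc _)).subtype_mk _)))
    exact (hcomp 0 ht0).fst.prodMk ((hcomp 0 ht0).snd.prodMk (hcomp 1 ht1).snd)
  have he : e 2 ∈ Metric.sphere (0 : EuclideanSpace ℝ (Fin 3)) 1 := by simp [e]
  have hte : ∀ i, i ≠ 2 → e i ∈ tangentSpace (Metric.sphere (0 : EuclideanSpace ℝ (Fin 3)) 1) (e 2) :=
    fun i hi => mem_tangentSpace_sphere (by simp [e]) (by simp [e]) (by rw [hee, if_neg hi.symm])
  have hte0 := hte 0 (by decide)
  have hte1 := hte 1 (by decide)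
  let f₀ : X × Ell2 × Ell2 := (m.base ⟨_, he⟩, (m.fibre ⟨_, he⟩ ⟨_, hte0⟩ : Ell2),
    (m.fibre ⟨_, he⟩ ⟨_, hte1⟩ : Ell2))
  have hΦ₀ : ∀ w : ℝ × ℝ, 1 ≤ w.1 ^ 2 + w.2 ^ 2 → Φ w = frameRefl f₀ w := by
    intro w hw
    have hmax : max 0 (1 - (w.1 ^ 2 + w.2 ^ 2)) = 0 := max_eq_left (by linarith)
    have hnw : n w = w.1 ^ 2 + w.2 ^ 2 := by simp [n, hmax]
    have h2 : H w (e 2) = e 2 := by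
      simp [H, e, ν, hmax, PiLp.inner_apply, Fin.sum_univ_three]
    have h0 : H w (e 0) = (1 - 2 * w.1 * w.1 / (w.1 ^ 2 + w.2 ^ 2)) • e 0 +
        (-(2 * w.1 * w.2 / (w.1 ^ 2 + w.2 ^ 2))) • e 1 := by
      ext i
      fin_cases i <;>
        simp [H, e, ν, hmax, PiLp.inner_apply, Fin.sum_univ_three, hnw] <;> ring
    have h1 : H w (e 1) = (-(2 * w.1 * w.2 / (w.1 ^ 2 + w.2 ^ 2))) • e 0 +
        (1 - 2 * w.2 * w.2 / (w.1 ^ 2 + w.2 ^ 2)) • e 1 := by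
      ext i
      fin_cases i <;>
        simp [H, e, ν, hmax, PiLp.inner_apply, Fin.sum_univ_three, hnw] <;> ring
    have aux : ∀ (x : EuclideanSpace ℝ (Fin 3)) (hx : x ∈ Metric.sphere (0 : EuclideanSpace ℝ (Fin 3)) 1)
        (u : EuclideanSpace ℝ (Fin 3)) (hu : u ∈ tangentSpace (Metric.sphere (0 : EuclideanSpace ℝ (Fin 3)) 1) x)
        (a b : ℝ), x = e 2 → u = a • e 0 + b • e 1 → m.base ⟨x, hx⟩ = f₀.1 ∧
          (m.fibre ⟨x, hx⟩ ⟨u, hu⟩ : Ell2) = a • f₀.2.1 + b • f₀.2.2 := by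
      rintro x hx u hu a b rfl rfl
      refine ⟨rfl, ?_⟩
      have : (⟨a • e 0 + b • e 1, hu⟩ :
          tangentSpace (Metric.sphere (0 : EuclideanSpace ℝ (Fin 3)) 1) (e 2)) =
          a • ⟨e 0, hte0⟩ + b • ⟨e 1, hte1⟩ := rfl
      rw [this, map_add, map_smul, map_smul]
      rfl
    have a0 := aux _ (hsph w) _ (ht0 w) _ _ h2 h0
    have a1 := aux _ (hsph w) _ (ht1 w) _ _ h2 h1
    exact Prod.ext a0.1 (Prod.ext a0.2 a1.2)
  -- Reflections are involutions, so `f₀` is recovered from `Φ (1, 0)`, which is known to be a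
  -- frame.
  have hf₀ : frameRefl (Φ (1, 0)) (1, 0) = f₀ := by
    rw [hΦ₀ _ (by norm_num)]
    simp only [frameRefl, frameMul]
    norm_num
  refine ⟨f₀, ?_, Φ, 1, one_pos, hΦc, hΦm, hΦ₀⟩
  rw [← hf₀]
  exact frameRefl_mem (hΦm _) (by norm_num)

/-- If `X` is path connected and `S²` has a `θ`-structure, then all reflection loops are
null-homotopic. -/
theorem reflLoopNull_of_sphere [PathConnectedSpace X]
    (hS : Nonempty (ThetaStructure θ (Metric.sphere (0 : EuclideanSpace ℝ (Fin 3)) 1)))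
    {f : X × Ell2 × Ell2} (hf : f ∈ frameSet θ) : ReflLoopNull θ f := by
  obtain ⟨f₀, hf₀, h⟩ := exists_reflLoopNull_of_sphere hS.some
  exact h.change_base hf₀ hf

end Sphere

/-! ### Adapted charts of submanifolds -/

section AdaptedCharts

variable {E : Type*} [NormedAddCommGroup E] [NormedSpace ℝ E]

/-- A smooth chart of the ambient space which takes `M` to a `d`-dimensional linear subspace. -/
structure IsAdaptedChart (d : ℕ) (M : Set E) (e : OpenPartialHomeomorph E E)
    (L : Submodule ℝ E) : Prop where
  contDiffOn : ContDiffOn ℝ ∞ e e.source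
  contDiffOn_symm : ContDiffOn ℝ ∞ e.symm e.target
  finiteDimensional : FiniteDimensional ℝ L
  finrank_eq : Module.finrank ℝ L = d
  mem_iff : ∀ y ∈ e.source, (y ∈ M ↔ e y ∈ L)

theorem IsSubmanifold.exists_chart {d : ℕ} {M : Set E} (h : IsSubmanifold d M) {x : E}
    (hx : x ∈ M) : ∃ (e : OpenPartialHomeomorph E E) (L : Submodule ℝ E),
      x ∈ e.source ∧ IsAdaptedChart d M e L := by
  obtain ⟨e, L, h1, h2, h3, h4, h5, h6⟩ := h x hx
  exact ⟨e, L, h1, h2, h3, h4, h5, h6⟩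

namespace IsAdaptedChart

variable {d : ℕ} {M : Set E} {e : OpenPartialHomeomorph E E} {L : Submodule ℝ E}

theorem hasFDerivAt (h : IsAdaptedChart d M e L) {x : E} (hx : x ∈ e.source) :
    HasFDerivAt e (fderiv ℝ e x) x :=
  ((h.contDiffOn.contDiffAt (e.open_source.mem_nhds hx)).differentiableAt (by simp)).hasFDerivAt

theorem hasFDerivAt_symm (h : IsAdaptedChart d M e L) {y : E} (hy : y ∈ e.target) :
    HasFDerivAt e.symm (fderiv ℝ e.symm y) y :=
  ((h.contDiffOn_symm.contDiffAt (e.open_target.mem_nhds hy)).differentiableAt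
    (by simp)).hasFDerivAt

theorem fderiv_symm_fderiv (h : IsAdaptedChart d M e L) {x : E} (hx : x ∈ e.source) (u : E) :
    fderiv ℝ e.symm (e x) (fderiv ℝ e x u) = u := by
  have h1 := (h.hasFDerivAt_symm (e.map_source hx)).comp x (h.hasFDerivAt hx)
  have h2 : HasFDerivAt (e.symm ∘ e) (ContinuousLinearMap.id ℝ E) x :=
    (hasFDerivAt_id x).congr_of_eventuallyEq
      (Filter.eventually_of_mem (e.open_source.mem_nhds hx) fun y hy => e.left_inv hy)
  exact congrArg (fun A : E →L[ℝ] E => A u) (h1.unique h2)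

theorem fderiv_fderiv_symm (h : IsAdaptedChart d M e L) {x : E} (hx : x ∈ e.source) (u : E) :
    fderiv ℝ e x (fderiv ℝ e.symm (e x) u) = u := by
  have h0 := h.hasFDerivAt hx
  have hy := e.map_source hx
  rw [← e.left_inv hx] at h0
  have h1 := h0.comp (e x) (h.hasFDerivAt_symm hy)
  have h2 : HasFDerivAt (e ∘ e.symm) (ContinuousLinearMap.id ℝ E) (e x) :=
    (hasFDerivAt_id _).congr_of_eventuallyEq
      (Filter.eventually_of_mem (e.open_target.mem_nhds hy) fun y hy => e.right_inv hy)
  have := congrArg (fun A : E →L[ℝ] E => A u) (h1.unique h2)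
  simpa [e.left_inv hx] using this

/-- The chart maps the tangent cone of `M` into that of `L`, which lies in `L` because a
finite-dimensional subspace is closed. Conversely, straight lines in `L` pull back to curves in `M`
with the required velocity. -/
theorem mem_tangentSpace_iff (h : IsAdaptedChart d M e L) {x : E} (hx : x ∈ e.source)
    (hxM : x ∈ M) (u : E) : u ∈ tangentSpace M x ↔ fderiv ℝ e x u ∈ L := by
  have := h.finiteDimensional
  have hcl : IsClosed (L : Set E) := L.closed_of_finiteDimensional
  have hexL : e x ∈ L := (h.mem_iff x hx).1 hxM
  constructor
  · suffices tangentSpace M x ≤ L.comap (fderiv ℝ e x).toLinearMap from fun hu => this hu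
    refine Submodule.span_le.2 fun u hu => ?_
    rw [← tangentConeAt_inter_nhds (e.open_source.mem_nhds hx)] at hu
    have h1 := (h.hasFDerivAt hx).hasFDerivWithinAt.mapsTo_tangent_cone hu
    have h2 : e '' (M ∩ e.source) ⊆ L := by
      rintro _ ⟨y, ⟨hyM, hy⟩, rfl⟩
      exact (h.mem_iff y hy).1 hyM
    obtain ⟨α, l, _, c, δ, -, hδ, hc⟩ :=
      exists_fun_of_mem_tangentConeAt (tangentConeAt_mono h2 h1)
    refine hcl.mem_of_tendsto hc (hδ.mono fun n hn => L.smul_mem _ ?_)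
    have := L.sub_mem hn hexL
    simpa using this
  · intro hu
    have hy := e.map_source hx
    refine mem_tangentSpace_of_hasDerivAt
      (c := fun s : ℝ => e.symm (e x + s • fderiv ℝ e x u)) ?_ (by simp [e.left_inv hx]) ?_
    · have h1 : HasDerivAt (fun s : ℝ => e x + s • fderiv ℝ e x u) (fderiv ℝ e x u) 0 := by
        simpa using ((hasDerivAt_id (0 : ℝ)).smul_const (fderiv ℝ e x u)).const_add (e x)
      have h2 := h.hasFDerivAt_symm hy
      have h3 : e x = e x + (0 : ℝ) • fderiv ℝ e x u := by simp
      rw [h3] at h2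
      have h4 := h2.comp_hasDerivAt (0 : ℝ) h1
      rw [← h3, h.fderiv_symm_fderiv hx] at h4
      exact h4
    · have hc : ContinuousAt (fun s : ℝ => e x + s • fderiv ℝ e x u) 0 := by fun_prop
      have : ∀ᶠ s : ℝ in 𝓝 0, e x + s • fderiv ℝ e x u ∈ e.target :=
        hc.eventually_mem (e.open_target.mem_nhds (by simpa using hy))
      filter_upwards [this] with s hs
      rw [h.mem_iff _ (e.map_target hs), e.right_inv hs]
      exact L.add_mem hexL (L.smul_mem _ hu)

theorem finrank_tangentSpace (h : IsAdaptedChart d M e L) {x : E} (hx : x ∈ e.source)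
    (hxM : x ∈ M) : Module.finrank ℝ (tangentSpace M x) = d := by
  let A : E ≃ₗ[ℝ] E := LinearEquiv.ofLinearMap (fderiv ℝ e.symm (e x)).toLinearMap
    (fderiv ℝ e x).toLinearMap (by ext u; exact h.fderiv_symm_fderiv hx u)
    (by ext u; exact h.fderiv_fderiv_symm hx u)
  have : tangentSpace M x = L.map A.toLinearMap := by
    ext u
    rw [h.mem_tangentSpace_iff hx hxM, Submodule.mem_map]
    constructor
    · exact fun hu => ⟨_, hu, h.fderiv_symm_fderiv hx u⟩
    · rintro ⟨y, hy, rfl⟩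
      exact (h.fderiv_fderiv_symm hx y).symm ▸ hy
  rw [this]
  exact (A.finrank_map_eq L).trans h.finrank_eq

theorem continuousOn_fderiv_symm (h : IsAdaptedChart d M e L) (u : E) :
    ContinuousOn (fun x => fderiv ℝ e.symm (e x) u) e.source :=
  ((h.contDiffOn_symm.continuousOn_fderiv_of_isOpen e.open_target (by simp)).comp
    e.continuousOn e.mapsTo).clm_apply continuousOn_const

end IsAdaptedChart

theorem IsSubmanifold.finrank_tangentSpace {d : ℕ} {M : Set E} (h : IsSubmanifold d M) {x : E}
    (hx : x ∈ M) : Module.finrank ℝ (tangentSpace M x) = d := by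
  obtain ⟨e, L, hxe, he⟩ := h.exists_chart hx
  exact he.finrank_tangentSpace hxe hx

end AdaptedCharts

/-! ### Bundle maps described by ambient data -/

section BundleData

variable {X : Type*} [TopologicalSpace X] {d : ℕ} {θ : C(X, BO d)}
  {E F E' F' : Type*} [NormedAddCommGroup E] [NormedAddCommGroup F] [NormedSpace ℝ F]
  [NormedAddCommGroup E'] [NormedAddCommGroup F'] [NormedSpace ℝ F']

/-- A bundle map over `M` given by everywhere defined functions: `b` is the map of base spaces and
`g x` a linear map that extends the isomorphism on the fibre `V x`. -/
structure IsBundleData (θ : C(X, BO d)) (M : Set E) (V : E → Submodule ℝ F) (b : E → X)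
    (g : E → F →ₗ[ℝ] Ell2) : Prop where
  mem : ∀ x ∈ M, ∀ u ∈ V x, g x u ∈ (θ (b x)).1
  inj : ∀ x ∈ M, ∀ u ∈ V x, g x u = 0 → u = 0
  cont_base : ContinuousOn b M
  cont_fibre : ContinuousOn (fun p : E × F => g p.1 p.2) {p | p.1 ∈ M ∧ p.2 ∈ V p.1}

/-- Total functions on the ambient space avoid dependent types over points and fibres when
structures are cut and glued. The extension off the fibres and off `M` is arbitrary, and no
continuity is claimed there. -/
theorem BundleMap.exists_isBundleData [Nonempty X] {M : Set E} {V : E → Submodule ℝ F}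
    (m : BundleMap θ M (fun x : M => V x)) :
    ∃ (b : E → X) (g : E → F →ₗ[ℝ] Ell2), IsBundleData θ M V b g ∧
      ∀ x (hx : x ∈ M), m.base ⟨x, hx⟩ = b x ∧
        ∀ u (hu : u ∈ V x), (m.fibre ⟨x, hx⟩ ⟨u, hu⟩ : Ell2) = g x u := by
  classical
  have key : ∀ x : E, ∃ (b : X) (g : F →ₗ[ℝ] Ell2), ∀ hx : x ∈ M, m.base ⟨x, hx⟩ = b ∧
        ∀ u (hu : u ∈ V x), (m.fibre ⟨x, hx⟩ ⟨u, hu⟩ : Ell2) = g u := by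
    intro x
    by_cases hx : x ∈ M
    · obtain ⟨g, hg⟩ := LinearMap.exists_extend
        ((θ (m.base ⟨x, hx⟩)).1.subtype ∘ₗ (m.fibre ⟨x, hx⟩).toLinearMap)
      refine ⟨m.base ⟨x, hx⟩, g, fun _ => ⟨rfl, fun u hu => ?_⟩⟩
      exact (congrArg (fun A => A ⟨u, hu⟩) hg).symm
    · exact ⟨Classical.arbitrary X, 0, fun h => absurd h hx⟩
  choose b g hbg using key
  refine ⟨b, g, ⟨fun x hx u hu => ?_, fun x hx u hu h0 => ?_, ?_, ?_⟩, hbg⟩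
  · rw [← (hbg x hx).1, ← (hbg x hx).2 u hu]
    exact Subtype.prop _
  · rw [← (hbg x hx).2 u hu] at h0
    have h1 : m.fibre ⟨x, hx⟩ ⟨u, hu⟩ = 0 := Subtype.ext h0
    have h2 := (m.fibre ⟨x, hx⟩).map_eq_zero_iff.1 h1
    exact congrArg Subtype.val h2
  · rw [continuousOn_iff_continuous_domRestrict]
    convert m.base.continuous using 1
    ext x
    exact ((hbg x x.2).1).symm
  · rw [continuousOn_iff_continuous_domRestrict]
    have h1 : Continuous fun p : {p : E × F | p.1 ∈ M ∧ p.2 ∈ V p.1} =>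
        (⟨(⟨p.1.1, p.2.1⟩, p.1.2), p.2.2⟩ : {p : M × F // p.2 ∈ V p.1}) := by
      fun_prop
    convert (continuous_subtype_val.comp (m.continuous_total.comp h1)).snd using 1
    ext1 p
    exact ((hbg _ p.2.1).2 _ p.2.2).symm

namespace IsBundleData

/-- Injectivity on fibres suffices since source and target both have dimension `d`; positivity of
`d` lets `finrank` certify that they are finite-dimensional. -/
theorem exists_bundleMap {M : Set E} {V : E → Submodule ℝ F} {b : E → X} {g : E → F →ₗ[ℝ] Ell2}
    (h : IsBundleData θ M V b g) (hd : 0 < d) (hV : ∀ x ∈ M, Module.finrank ℝ (V x) = d) :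
    ∃ m : BundleMap θ M (fun x : M => V x), ∀ x (hx : x ∈ M), m.base ⟨x, hx⟩ = b x ∧
        ∀ u (hu : u ∈ V x), (m.fibre ⟨x, hx⟩ ⟨u, hu⟩ : Ell2) = g x u := by
  let A : ∀ x : M, V x →ₗ[ℝ] (θ (b x)).1 := fun x =>
    ((g x).domRestrict (V x)).codRestrict _ fun u => h.mem x x.2 u u.2
  have hA : ∀ x, Function.Bijective (A x) := by
    intro x
    have hinj : Function.Injective (A x) := by
      rw [← LinearMap.ker_eq_bot, LinearMap.ker_eq_bot']
      intro u hu
      exact Subtype.ext (h.inj x x.2 u u.2 (congrArg Subtype.val hu))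
    refine ⟨hinj, ?_⟩
    have h1 := hV x x.2
    have h2 := (θ (b x)).2.1
    have : FiniteDimensional ℝ (V x) := Module.finite_of_finrank_pos (by omega)
    have : FiniteDimensional ℝ (θ (b x)).1 := Module.finite_of_finrank_pos (by omega)
    exact (LinearMap.injective_iff_surjective_of_finrank_eq_finrank (h1.trans h2.symm)).1 hinj
  refine ⟨⟨⟨fun x => b x, continuousOn_iff_continuous_domRestrict.1 h.cont_base⟩,
    fun x => LinearEquiv.ofBijective (A x) (hA x), ?_⟩, fun x hx => ⟨rfl, fun u hu => rfl⟩⟩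
  have h1 : Continuous fun p : {p : M × F // p.2 ∈ V p.1} =>
      (⟨(p.1.1.1, p.1.2), p.1.1.2, p.2⟩ : {p : E × F | p.1 ∈ M ∧ p.2 ∈ V p.1}) := by
    fun_prop
  have h2 := (continuousOn_iff_continuous_domRestrict.1 h.cont_fibre).comp h1
  have h3 : Continuous fun p : {p : M × F // p.2 ∈ V p.1} => b p.1.1 :=
    (continuousOn_iff_continuous_domRestrict.1 h.cont_base).comp
      (continuous_fst.comp continuous_subtype_val)
  exact (h3.prodMk h2).subtype_mk _

theorem pullback {M : Set E} {V : E → Submodule ℝ F} {b : E → X} {g : E → F →ₗ[ℝ] Ell2}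
    (h : IsBundleData θ M V b g) {M' : Set E'} {V' : E' → Submodule ℝ F'} {φ : E' → E}
    {A : E' → F' →ₗ[ℝ] F} (hφ : ContinuousOn φ M') (hM : MapsTo φ M' M)
    (hA : ContinuousOn (fun p : E' × F' => A p.1 p.2) {p | p.1 ∈ M' ∧ p.2 ∈ V' p.1})
    (hV : ∀ x ∈ M', ∀ u ∈ V' x, A x u ∈ V (φ x))
    (hinj : ∀ x ∈ M', ∀ u ∈ V' x, A x u = 0 → u = 0) :
    IsBundleData θ M' V' (b ∘ φ) (fun x => g (φ x) ∘ₗ A x) where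
  mem x hx u hu := h.mem _ (hM hx) _ (hV x hx u hu)
  inj x hx u hu h0 := hinj x hx u hu (h.inj _ (hM hx) _ (hV x hx u hu) h0)
  cont_base := h.cont_base.comp hφ hM
  cont_fibre := by
    have h1 : ContinuousOn (fun p : E' × F' => (φ p.1, A p.1 p.2))
        {p | p.1 ∈ M' ∧ p.2 ∈ V' p.1} :=
      (hφ.comp continuousOn_fst fun p hp => hp.1).prodMk hA
    exact h.cont_fibre.comp h1 fun p hp => ⟨hM hp.1, hV _ hp.1 _ hp.2⟩

theorem mono {M M' : Set E} {V V' : E → Submodule ℝ F} {b : E → X} {g : E → F →ₗ[ℝ] Ell2}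
    (h : IsBundleData θ M V b g) (hM : M' ⊆ M) (hV : ∀ x ∈ M', V' x ≤ V x) :
    IsBundleData θ M' V' b g :=
  h.pullback (φ := id) (A := fun _ => LinearMap.id) continuousOn_id hM continuousOn_snd hV
    fun _ _ _ _ h => h

/-- All conditions are local on `M`. Local data need to match only on vectors of `V`, which permits
gluing linear maps whose arbitrary extensions differ. -/
theorem of_local {M : Set E} {V : E → Submodule ℝ F} {b : E → X} {g : E → F →ₗ[ℝ] Ell2}
    (h : ∀ x ∈ M, ∃ (O : Set E) (b₀ : E → X) (g₀ : E → F →ₗ[ℝ] Ell2), IsOpen O ∧ x ∈ O ∧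
      IsBundleData θ (M ∩ O) V b₀ g₀ ∧
      ∀ y ∈ M ∩ O, b y = b₀ y ∧ ∀ u ∈ V y, g y u = g₀ y u) :
    IsBundleData θ M V b g := by
  refine ⟨fun x hx u hu => ?_, fun x hx u hu h0 => ?_, fun x hx => ?_, fun p hp => ?_⟩
  · obtain ⟨O, b₀, g₀, -, hxO, h0, heq⟩ := h x hx
    rw [(heq x ⟨hx, hxO⟩).1, (heq x ⟨hx, hxO⟩).2 u hu]
    exact h0.mem x ⟨hx, hxO⟩ u hu
  · obtain ⟨O, b₀, g₀, -, hxO, h1, heq⟩ := h x hx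
    rw [(heq x ⟨hx, hxO⟩).2 u hu] at h0
    exact h1.inj x ⟨hx, hxO⟩ u hu h0
  · obtain ⟨O, b₀, g₀, hO, hxO, h1, heq⟩ := h x hx
    rw [← continuousWithinAt_inter (hO.mem_nhds hxO)]
    exact (h1.cont_base x ⟨hx, hxO⟩).congr (fun y hy => (heq y hy).1) (heq x ⟨hx, hxO⟩).1
  · obtain ⟨O, b₀, g₀, hO, hxO, h1, heq⟩ := h p.1 hp.1
    have hO' : IsOpen {q : E × F | q.1 ∈ O} := hO.preimage continuous_fst
    rw [← continuousWithinAt_inter (hO'.mem_nhds hxO)]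
    refine ((h1.cont_fibre p ⟨⟨hp.1, hxO⟩, hp.2⟩).mono ?_).congr ?_ ?_
    · rintro q ⟨⟨hq1, hq2⟩, hq3⟩
      exact ⟨⟨hq1, hq3⟩, hq2⟩
    · rintro q ⟨⟨hq1, hq2⟩, hq3⟩
      exact (heq q.1 ⟨hq1, hq3⟩).2 _ hq2
    · exact (heq p.1 ⟨hp.1, hxO⟩).2 _ hp.2

end IsBundleData

end BundleData

/-! ### The inner product of `ℝ × ℓ²` and orthonormal frames -/

section OrthonormalFrames

/-- The inner product of `ℝ × ℓ²`. -/
def ip (u v : ℝ × Ell2) : ℝ := u.1 * v.1 + inner ℝ u.2 v.2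

theorem ip_comm (u v : ℝ × Ell2) : ip u v = ip v u := by
  simp only [ip, real_inner_comm u.2, mul_comm u.1]

theorem ip_add_left (u v w : ℝ × Ell2) : ip (u + v) w = ip u w + ip v w := by
  simp only [ip, Prod.fst_add, Prod.snd_add, inner_add_left]; ring

theorem ip_smul_left (a : ℝ) (u w : ℝ × Ell2) : ip (a • u) w = a * ip u w := by
  simp only [ip, Prod.smul_fst, Prod.smul_snd, inner_smul_left, smul_eq_mul, conj_trivial]; ring

theorem ip_sub_left (u v w : ℝ × Ell2) : ip (u - v) w = ip u w - ip v w := by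
  simp only [ip, Prod.fst_sub, Prod.snd_sub, inner_sub_left]; ring

theorem ip_add_right (u v w : ℝ × Ell2) : ip w (u + v) = ip w u + ip w v := by
  simp only [ip_comm w, ip_add_left]

theorem ip_smul_right (a : ℝ) (u w : ℝ × Ell2) : ip w (a • u) = a * ip w u := by
  simp only [ip_comm w, ip_smul_left]

theorem ip_sub_right (u v w : ℝ × Ell2) : ip w (u - v) = ip w u - ip w v := by
  simp only [ip_comm w, ip_sub_left]

theorem ip_self_pos {u : ℝ × Ell2} (hu : u ≠ 0) : 0 < ip u u := by
  simp only [ip]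
  rcases eq_or_ne u.1 0 with h | h
  · have h2 : u.2 ≠ 0 := fun h2 => hu (Prod.ext h h2)
    have := real_inner_self_pos.2 h2
    nlinarith [mul_self_nonneg u.1]
  · have := real_inner_self_nonneg (x := u.2)
    have := mul_self_pos.2 h
    linarith

theorem continuous_ip : Continuous fun p : (ℝ × Ell2) × (ℝ × Ell2) => ip p.1 p.2 := by
  unfold ip
  fun_prop

theorem _root_.ContinuousOn.ip {Y : Type*} [TopologicalSpace Y] {f g : Y → ℝ × Ell2} {s : Set Y}
    (hf : ContinuousOn f s) (hg : ContinuousOn g s) :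
    ContinuousOn (fun y => CobCat.ip (f y) (g y)) s :=
  continuous_ip.comp_continuousOn (hf.prodMk hg)

/-- The linear map which sends `u` to `⟨u, v⟩ y`. -/
def ipSmul (v : ℝ × Ell2) {F : Type*} [AddCommGroup F] [Module ℝ F] (y : F) :
    (ℝ × Ell2) →ₗ[ℝ] F where
  toFun u := ip u v • y
  map_add' u w := by rw [ip_add_left, add_smul]
  map_smul' a u := by rw [ip_smul_left, mul_smul, RingHom.id_apply]

/-- The reflection in the hyperplane orthogonal to `v`. -/
def reflect (v : ℝ × Ell2) : (ℝ × Ell2) →ₗ[ℝ] (ℝ × Ell2) :=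
  LinearMap.id - ipSmul v ((2 / ip v v) • v)

theorem reflect_apply (v u : ℝ × Ell2) : reflect v u = u - (2 * ip u v / ip v v) • v := by
  simp only [reflect, LinearMap.sub_apply, LinearMap.id_apply, ipSmul, LinearMap.coe_mk,
    AddHom.coe_mk, smul_smul]
  congr 2
  ring

theorem reflect_reflect {v : ℝ × Ell2} (hv : v ≠ 0) (u : ℝ × Ell2) :
    reflect v (reflect v u) = u := by
  have := (ip_self_pos hv).ne'
  simp only [reflect_apply, ip_sub_left, ip_smul_left]
  match_scalars
  · ring
  · field_simp
    ring

/-- `v₁` and `v₂` form an orthonormal basis of the plane `P`. -/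
structure IsOrthonormalFrame (P : Submodule ℝ (ℝ × Ell2)) (v₁ v₂ : ℝ × Ell2) : Prop where
  mem₁ : v₁ ∈ P
  mem₂ : v₂ ∈ P
  ip₁₁ : ip v₁ v₁ = 1
  ip₂₂ : ip v₂ v₂ = 1
  ip₁₂ : ip v₁ v₂ = 0
  eq : ∀ u ∈ P, u = ip u v₁ • v₁ + ip u v₂ • v₂

theorem IsOrthonormalFrame.of_finrank {P : Submodule ℝ (ℝ × Ell2)} {v₁ v₂ : ℝ × Ell2}
    (hP : Module.finrank ℝ P = 2) (h1 : v₁ ∈ P) (h2 : v₂ ∈ P) (h11 : ip v₁ v₁ = 1)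
    (h22 : ip v₂ v₂ = 1) (h12 : ip v₁ v₂ = 0) : IsOrthonormalFrame P v₁ v₂ := by
  refine ⟨h1, h2, h11, h22, h12, fun u hu => ?_⟩
  have : FiniteDimensional ℝ P := Module.finite_of_finrank_eq_succ hP
  have h21 : ip v₂ v₁ = 0 := by rw [ip_comm, h12]
  have hli : LinearIndependent ℝ ![(⟨v₁, h1⟩ : P), ⟨v₂, h2⟩] := by
    rw [LinearIndependent.pair_iff]
    intro a b hab
    have hab' : a • v₁ + b • v₂ = 0 := congrArg Subtype.val hab
    have e1 := congrArg (fun u => ip u v₁) hab'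
    have e2 := congrArg (fun u => ip u v₂) hab'
    simp only [ip_add_left, ip_smul_left, h11, h12, h21, h22] at e1 e2
    simp [ip] at e1 e2
    exact ⟨e1, e2⟩
  have htop := hli.span_eq_top_of_card_eq_finrank (by simp [hP])
  have : (⟨u, hu⟩ : P) ∈ Submodule.span ℝ (range ![(⟨v₁, h1⟩ : P), ⟨v₂, h2⟩]) := by
    rw [htop]; trivial
  simp only [Matrix.range_cons, Matrix.range_empty, union_empty, singleton_union] at this
  obtain ⟨a, b, hab⟩ := Submodule.mem_span_pair.1 this
  have hab' : a • v₁ + b • v₂ = u := congrArg Subtype.val hab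
  rw [← hab']
  simp [ip_add_left, ip_smul_left, h11, h12, h21, h22]

/-- Gram–Schmidt for `ip`, whose formulas depend continuously on the frame. -/
theorem exists_orthonormalFrame {Y : Type*} [TopologicalSpace Y] {s : Set Y}
    {P : Y → Submodule ℝ (ℝ × Ell2)} {f₁ f₂ : Y → ℝ × Ell2} (hP : ∀ y ∈ s, Module.finrank ℝ (P y) = 2)
    (hf₁ : ContinuousOn f₁ s) (hf₂ : ContinuousOn f₂ s) (h₁ : ∀ y ∈ s, f₁ y ∈ P y)
    (h₂ : ∀ y ∈ s, f₂ y ∈ P y) (hli : ∀ y ∈ s, ∀ a b : ℝ, a • f₁ y + b • f₂ y = 0 → a = 0 ∧ b = 0) :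
    ∃ v₁ v₂ : Y → ℝ × Ell2, ContinuousOn v₁ s ∧ ContinuousOn v₂ s ∧
      ∀ y ∈ s, IsOrthonormalFrame (P y) (v₁ y) (v₂ y) := by
  have norm_unit : ∀ u : ℝ × Ell2, u ≠ 0 → ip ((√(ip u u))⁻¹ • u) ((√(ip u u))⁻¹ • u) = 1 := by
    intro u hu
    have h := ip_self_pos hu
    have h' := (Real.sqrt_pos.2 h).ne'
    rw [ip_smul_left, ip_smul_right]
    field_simp
    exact (Real.sq_sqrt h.le).symm
  have norm_cont : ∀ f : Y → ℝ × Ell2, ContinuousOn f s → (∀ y ∈ s, f y ≠ 0) →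
      ContinuousOn (fun y => (√(ip (f y) (f y)))⁻¹ • f y) s := fun f hf h0 =>
    ((hf.ip hf).sqrt.inv₀ fun y hy => (Real.sqrt_pos.2 (ip_self_pos (h0 y hy))).ne').smul hf
  have hn₁ : ∀ y ∈ s, f₁ y ≠ 0 := fun y hy h0 => by
    have := (hli y hy 1 0 (by simp [h0])).1
    norm_num at this
  let v₁ : Y → ℝ × Ell2 := fun y => (√(ip (f₁ y) (f₁ y)))⁻¹ • f₁ y
  have hv₁ : ContinuousOn v₁ s := norm_cont f₁ hf₁ hn₁
  have hv₁₁ : ∀ y ∈ s, ip (v₁ y) (v₁ y) = 1 := fun y hy => norm_unit _ (hn₁ y hy)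
  let z : Y → ℝ × Ell2 := fun y => f₂ y - ip (f₂ y) (v₁ y) • v₁ y
  have hz : ContinuousOn z s := hf₂.sub ((hf₂.ip hv₁).smul hv₁)
  have hzn : ∀ y ∈ s, z y ≠ 0 := fun y hy h0 => by
    have := (hli y hy (-(ip (f₂ y) (v₁ y) * (√(ip (f₁ y) (f₁ y)))⁻¹)) 1 (by
      rw [← h0]; simp only [z, v₁]; module)).2
    norm_num at this
  refine ⟨v₁, fun y => (√(ip (z y) (z y)))⁻¹ • z y, hv₁, norm_cont z hz hzn, fun y hy => ?_⟩
  have m₁ : v₁ y ∈ P y := (P y).smul_mem _ (h₁ y hy)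
  refine .of_finrank (hP y hy) m₁
    ((P y).smul_mem _ ((P y).sub_mem (h₂ y hy) ((P y).smul_mem _ m₁))) (hv₁₁ y hy)
    (norm_unit _ (hzn y hy)) ?_
  have h0 : ip (v₁ y) (z y) = 0 := by
    change ip (v₁ y) (f₂ y - ip (f₂ y) (v₁ y) • v₁ y) = 0
    rw [ip_sub_right, ip_smul_right, hv₁₁ y hy, ip_comm (v₁ y) (f₂ y)]
    ring
  rw [ip_smul_right, h0, mul_zero]

/-- Near each of its points, a surface has an orthonormal frame and is contractible. -/
theorem IsSubmanifold.exists_frame_contraction {W : Set (ℝ × Ell2)} (hW : IsSubmanifold 2 W)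
    {p : ℝ × Ell2} (hp : p ∈ W) :
    ∃ (U : Set (ℝ × Ell2)) (v₁ v₂ : ℝ × Ell2 → ℝ × Ell2) (c : (ℝ × Ell2) × ℝ → ℝ × Ell2),
      IsOpen U ∧ p ∈ U ∧ ContinuousOn v₁ (W ∩ U) ∧ ContinuousOn v₂ (W ∩ U) ∧
      (∀ x ∈ W ∩ U, IsOrthonormalFrame (tangentSpace W x) (v₁ x) (v₂ x)) ∧
      ContinuousOn c ((W ∩ U) ×ˢ Icc 0 1) ∧ MapsTo c ((W ∩ U) ×ˢ Icc 0 1) (W ∩ U) ∧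
      ∀ x ∈ W ∩ U, c (x, 0) = p ∧ c (x, 1) = x := by
  obtain ⟨e, L, hpe, he⟩ := hW.exists_chart hp
  have hL := he.finrank_eq
  have : FiniteDimensional ℝ L := he.finiteDimensional
  let b := Module.finBasisOfFinrankEq ℝ L hL
  -- On the preimage of a ball the contraction is along straight segments in the chart; they stay in
  -- `L`, hence in `W`.
  obtain ⟨r, hr, hball⟩ := Metric.isOpen_iff.1 e.open_target (e p) (e.map_source hpe)
  let U : Set (ℝ × Ell2) := e.source ∩ e ⁻¹' Metric.ball (e p) r
  have hU : IsOpen U := e.isOpen_inter_preimage Metric.isOpen_ball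
  have hepL : e p ∈ L := (he.mem_iff p hpe).1 hp
  obtain ⟨v₁, v₂, hv₁, hv₂, hv⟩ := exists_orthonormalFrame (s := W ∩ U)
    (P := fun x => tangentSpace W x) (f₁ := fun x => fderiv ℝ e.symm (e x) (b 0 : ℝ × Ell2))
    (f₂ := fun x => fderiv ℝ e.symm (e x) (b 1 : ℝ × Ell2))
    (fun x hx => he.finrank_tangentSpace hx.2.1 hx.1)
    ((he.continuousOn_fderiv_symm _).mono fun x hx => hx.2.1)
    ((he.continuousOn_fderiv_symm _).mono fun x hx => hx.2.1)
    (fun x hx => by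
      rw [he.mem_tangentSpace_iff hx.2.1 hx.1, he.fderiv_fderiv_symm hx.2.1]
      exact (b 0).2)
    (fun x hx => by
      rw [he.mem_tangentSpace_iff hx.2.1 hx.1, he.fderiv_fderiv_symm hx.2.1]
      exact (b 1).2)
    (fun x hx s t hst => by
      have h1 := congrArg (fderiv ℝ e x) hst
      rw [map_add, map_smul, map_smul, he.fderiv_fderiv_symm hx.2.1,
        he.fderiv_fderiv_symm hx.2.1, (fderiv ℝ e x).map_zero] at h1
      have h2 : s • b 0 + t • b 1 = 0 := Subtype.ext h1
      have h3 := Fintype.linearIndependent_iff.1 b.linearIndependent ![s, t]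
        (by simpa [Fin.sum_univ_two] using h2)
      exact ⟨h3 0, h3 1⟩)
  have hseg : ∀ z ∈ (W ∩ U) ×ˢ Icc (0 : ℝ) 1, e p + z.2 • (e z.1 - e p) ∈ Metric.ball (e p) r :=
    fun z hz => by
      have := (convex_ball (e p) r) (Metric.mem_ball_self hr) hz.1.2.2 (sub_nonneg.2 hz.2.2) hz.2.1
        (by ring)
      convert this using 1
      module
  refine ⟨U, v₁, v₂, fun z => e.symm (e p + z.2 • (e z.1 - e p)), hU,
    ⟨hpe, Metric.mem_ball_self hr⟩, hv₁, hv₂, hv, ?_, ?_, fun x hx => ?_⟩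
  · refine e.continuousOn_symm.comp ?_ fun z hz => hball (hseg z hz)
    have h1 : ContinuousOn (fun z : (ℝ × Ell2) × ℝ => e z.1) ((W ∩ U) ×ˢ Icc 0 1) :=
      e.continuousOn.comp continuousOn_fst fun z hz => hz.1.2.1
    exact continuousOn_const.add (continuousOn_snd.smul (h1.sub continuousOn_const))
  · intro z hz
    have h1 := hball (hseg z hz)
    have h2 := e.map_target h1
    refine ⟨?_, h2, ?_⟩
    · rw [he.mem_iff _ h2, e.right_inv h1]
      exact L.add_mem hepL (L.smul_mem _ (L.sub_mem ((he.mem_iff _ hz.1.2.1).1 hz.1.1) hepL))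
    · rw [mem_preimage, e.right_inv h1]
      exact hseg z hz
  · simp [e.left_inv hpe, e.left_inv hx.2.1]

variable {X : Type*}

/-- The linear map which takes the orthonormal frame `(v₁, v₂)` to the frame `f`. -/
def frameMap (v₁ v₂ : ℝ × Ell2) (f : X × Ell2 × Ell2) : (ℝ × Ell2) →ₗ[ℝ] Ell2 :=
  ipSmul v₁ f.2.1 + ipSmul v₂ f.2.2

theorem frameMap_apply (v₁ v₂ : ℝ × Ell2) (f : X × Ell2 × Ell2) (u : ℝ × Ell2) :
    frameMap v₁ v₂ f u = ip u v₁ • f.2.1 + ip u v₂ • f.2.2 := rfl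

theorem IsBundleData.of_frame [TopologicalSpace X] {θ : C(X, BO 2)} {M : Set (ℝ × Ell2)} {V : ℝ × Ell2 → Submodule ℝ (ℝ × Ell2)}
    {v₁ v₂ : ℝ × Ell2 → ℝ × Ell2} {f : ℝ × Ell2 → X × Ell2 × Ell2}
    (hv₁ : ContinuousOn v₁ M) (hv₂ : ContinuousOn v₂ M)
    (hv : ∀ x ∈ M, IsOrthonormalFrame (V x) (v₁ x) (v₂ x)) (hf : ContinuousOn f M)
    (hmem : ∀ x ∈ M, f x ∈ frameSet θ) :
    IsBundleData θ M V (fun x => (f x).1) (fun x => frameMap (v₁ x) (v₂ x) (f x)) where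
  mem x hx u hu := by
    rw [frameMap_apply]
    exact Submodule.add_mem _ (Submodule.smul_mem _ _ (hmem x hx).1)
      (Submodule.smul_mem _ _ (hmem x hx).2.1)
  inj x hx u hu h0 := by
    have h1 := (hmem x hx).2.2 _ _ h0
    rw [(hv x hx).eq u hu, h1.1, h1.2]
    simp
  cont_base := hf.fst
  cont_fibre := by
    simp only [frameMap_apply]
    have h : MapsTo Prod.fst {p : (ℝ × Ell2) × (ℝ × Ell2) | p.1 ∈ M ∧ p.2 ∈ V p.1} M :=
      fun p hp => hp.1
    exact ((continuousOn_snd.ip (hv₁.comp continuousOn_fst h)).smul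
      (hf.snd.fst.comp continuousOn_fst h)).add
      ((continuousOn_snd.ip (hv₂.comp continuousOn_fst h)).smul
      (hf.snd.snd.comp continuousOn_fst h))

end OrthonormalFrames

/-! ### Tangent vector fields with countably many zeros -/

section VectorFields

/-- A consequence of Sard's theorem: a differentiable map between spaces of the same dimension has a
countable fibre. -/
theorem exists_countable_fibre {L : Type*} [NormedAddCommGroup L] [NormedSpace ℝ L]
    [FiniteDimensional ℝ L] {f : L → L} {O : Set L} (hf : ∀ y ∈ O, DifferentiableAt ℝ f y) :
    ∃ a, {y ∈ O | f y = a}.Countable := by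
  let _ : MeasurableSpace L := borel L
  have : BorelSpace L := ⟨rfl⟩
  let μ : MeasureTheory.Measure L := MeasureTheory.Measure.addHaar
  let C : Set L := {y ∈ O | (fderiv ℝ f y).det = 0}
  have h0 : μ (f '' C) = 0 :=
    MeasureTheory.addHaar_image_eq_zero_of_det_fderivWithin_eq_zero μ
      (fun y hy => (hf y hy.1).hasFDerivAt.hasFDerivWithinAt) fun y hy => hy.2
  -- The critical values form a null set, so a regular value exists. Its fibre is discrete by
  -- injectivity of the derivative, and a discrete Lindelöf set is countable.
  obtain ⟨a, ha⟩ : ∃ a, a ∉ f '' C := by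
    by_contra! h
    have : f '' C = univ := eq_univ_of_forall h
    rw [this] at h0
    exact NeZero.ne μ (MeasureTheory.Measure.measure_univ_eq_zero.1 h0)
  refine ⟨a, ?_⟩
  have hd : IsDiscrete {y ∈ O | f y = a} := by
    rw [isDiscrete_iff_nhdsNE]
    rintro y ⟨hyO, hya⟩
    have hdet : (fderiv ℝ f y).det ≠ 0 := fun h => ha ⟨y, ⟨hyO, h⟩, hya⟩
    have hanti : ∃ C, AntilipschitzWith C (fderiv ℝ f y) :=
      ⟨_, ((fderiv ℝ f y).toContinuousLinearEquivOfDetNeZero hdet).antilipschitz⟩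
    have := (hf y hyO).hasFDerivAt.eventually_ne (c := a) hanti
    exact Filter.inf_principal_eq_bot.2 (this.mono fun z hz h => hz h.2)
  exact (HereditarilyLindelofSpace.isLindelof _).countable_of_isDiscrete hd

/-- Add `ρ` times the chart's constant field `a ∈ L` to `v`. Where `ρ ≠ 0`, zeros of the sum are
solutions of `f = a` for the map `f` that is minus `v / ρ` read in the chart, so `a` is chosen with
a countable fibre. -/
theorem IsAdaptedChart.exists_perturbation {E : Type*} [NormedAddCommGroup E] [NormedSpace ℝ E]
    {d : ℕ} {M : Set E} {e : OpenPartialHomeomorph E E} {L : Submodule ℝ E}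
    (h : IsAdaptedChart d M e L) {v : E → E} (hv : Differentiable ℝ v)
    (hvt : ∀ x ∈ M, v x ∈ tangentSpace M x) {ρ : E → ℝ} (hρ : Differentiable ℝ ρ)
    (hsupp : tsupport ρ ⊆ e.source) :
    ∃ w : E → E, Differentiable ℝ w ∧ (∀ x ∈ M, w x ∈ tangentSpace M x) ∧
      (∀ x, ρ x = 0 → w x = v x) ∧ {x ∈ M | ρ x ≠ 0 ∧ w x = 0}.Countable := by
  have := h.finiteDimensional
  obtain ⟨π, hπ⟩ := Submodule.ClosedComplemented.of_finiteDimensional (𝕜 := ℝ) L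
  let f : L → L := fun y =>
    -((ρ (e.symm y))⁻¹ • π (fderiv ℝ e (e.symm y) (v (e.symm y))))
  let O : Set L := {y | (y : E) ∈ e.target ∧ ρ (e.symm y) ≠ 0}
  have hsrc : ∀ x, ρ x ≠ 0 → x ∈ e.source := fun x hx => hsupp (subset_tsupport ρ hx)
  have hDe : ContDiffOn ℝ ∞ (fderiv ℝ e) e.source :=
    h.contDiffOn.fderiv_of_isOpen e.open_source (by simp)
  have hDs : ContDiffOn ℝ ∞ (fderiv ℝ e.symm) e.target :=
    h.contDiffOn_symm.fderiv_of_isOpen e.open_target (by simp)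
  have hf : ∀ y ∈ O, DifferentiableAt ℝ f y := by
    intro y hy
    have h1 : DifferentiableAt ℝ (fun y : L => e.symm (y : E)) y :=
      (h.hasFDerivAt_symm hy.1).differentiableAt.comp y L.subtypeL.differentiableAt
    have h2 : DifferentiableAt ℝ (fun y : L => fderiv ℝ e (e.symm (y : E))) y :=
      ((hDe.contDiffAt (e.open_source.mem_nhds (e.map_target hy.1))).differentiableAt
        (by simp)).comp y h1
    have h3 : DifferentiableAt ℝ (fun y : L => v (e.symm (y : E))) y := (hv _).comp y h1
    have h4 : DifferentiableAt ℝ (fun y : L => ρ (e.symm (y : E))) y := (hρ _).comp y h1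
    exact ((h4.inv hy.2).smul (π.differentiableAt.comp y (h2.clm_apply h3))).neg
  obtain ⟨a, ha⟩ := exists_countable_fibre hf
  have hX : ∀ x ∈ e.source, DifferentiableAt ℝ (fun x => fderiv ℝ e.symm (e x) (a : E)) x := by
    intro x hx
    exact (((hDs.contDiffAt (e.open_target.mem_nhds (e.map_source hx))).differentiableAt
      (by simp)).comp x (h.hasFDerivAt hx).differentiableAt).clm_apply (differentiableAt_const _)
  refine ⟨fun x => v x + ρ x • fderiv ℝ e.symm (e x) (a : E), ?_, ?_, fun x hx => by simp [hx], ?_⟩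
  · intro x
    refine (hv x).add ?_
    by_cases hx : x ∈ tsupport ρ
    · exact (hρ x).smul (hX x (hsupp hx))
    · have h0 : (fun x => ρ x • fderiv ℝ e.symm (e x) (a : E)) =ᶠ[𝓝 x] fun _ => 0 := by
        filter_upwards [(isClosed_tsupport ρ).isOpen_compl.mem_nhds hx] with y hy
        rw [image_eq_zero_of_notMem_tsupport hy, zero_smul]
      exact (differentiableAt_const _).congr_of_eventuallyEq h0
  · intro x hx
    refine Submodule.add_mem _ (hvt x hx) ?_
    by_cases h0 : ρ x = 0
    · simp [h0]
    · refine Submodule.smul_mem _ _ ?_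
      rw [h.mem_tangentSpace_iff (hsrc x h0) hx, h.fderiv_fderiv_symm (hsrc x h0)]
      exact a.2
  · refine (ha.image fun y : L => e.symm y).mono ?_
    rintro x ⟨hxM, hx0, hw⟩
    have hxs := hsrc x hx0
    have hxL : e x ∈ L := (h.mem_iff x hxs).1 hxM
    refine ⟨⟨e x, hxL⟩, ⟨⟨e.map_source hxs, ?_⟩, ?_⟩, e.left_inv hxs⟩
    · simpa only [e.left_inv hxs] using hx0
    · have h1 := congrArg (fun u => π (fderiv ℝ e x u)) hw
      simp only [map_add, map_smul, h.fderiv_fderiv_symm hxs, hπ, map_zero] at h1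
      simp only [f, e.left_inv hxs]
      rw [eq_neg_of_add_eq_zero_left h1, smul_neg, neg_neg, smul_smul, inv_mul_cancel₀ hx0, one_smul]

/-- The product norm on `ℝ × ℓ²` is a maximum and not differentiable, so the bump is built from the
Hilbert square distance `N`. -/
theorem exists_bump {O : Set (ℝ × Ell2)} (hO : IsOpen O) {p : ℝ × Ell2} (hp : p ∈ O) :
    ∃ β : ℝ × Ell2 → ℝ, Differentiable ℝ β ∧ β p ≠ 0 ∧ tsupport β ⊆ O := by
  obtain ⟨R, hR, hball⟩ := Metric.isOpen_iff.1 hO p hp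
  let N : ℝ × Ell2 → ℝ := fun x => (x.1 - p.1) ^ 2 + ‖x.2 - p.2‖ ^ 2
  have hN : Differentiable ℝ N := by
    intro x
    refine DifferentiableAt.add (by fun_prop) (DifferentiableAt.norm_sq ℝ (by fun_prop))
  refine ⟨fun x => Real.smoothTransition ((R / 2) ^ 2 - N x), ?_, ?_, ?_⟩
  · exact (Real.smoothTransition.contDiff (n := 1)).differentiable (by simp) |>.comp
      ((differentiable_const _).sub hN)
  · have : 0 < (R / 2) ^ 2 - N p := by
      have h0 : N p = 0 := by simp [N]
      rw [h0, sub_zero]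
      exact pow_pos (half_pos hR) 2
    exact (Real.smoothTransition.pos_of_pos this).ne'
  · have hcl : IsClosed {x | N x ≤ (R / 2) ^ 2} := isClosed_le hN.continuous continuous_const
    refine (closure_minimal (fun x hx => ?_) hcl).trans fun x hx => hball ?_
    · by_contra hcon
      exact hx (Real.smoothTransition.zero_of_nonpos (by simpa using (not_le.1 hcon).le))
    · have hx' : (x.1 - p.1) ^ 2 + ‖x.2 - p.2‖ ^ 2 ≤ (R / 2) ^ 2 := hx
      have h1 : |x.1 - p.1| ≤ R / 2 :=
        abs_le_of_sq_le_sq (by nlinarith [sq_nonneg ‖x.2 - p.2‖]) (by positivity)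
      have h2 : ‖x.2 - p.2‖ ≤ R / 2 :=
        le_of_sq_le_sq (by nlinarith [sq_nonneg (x.1 - p.1)]) (by positivity)
      rw [Metric.mem_ball, Prod.dist_eq, max_lt_iff, Real.dist_eq, dist_eq_norm]
      constructor <;> linarith

/-- Perturb chart by chart over a finite cover of `K`. Each perturbation is supported where `κ * β p
≠ 0` and leaves the field unchanged elsewhere, so the zeros already treated remain in a countable
union and the values where `κ = 0` are kept. -/
theorem IsSubmanifold.exists_generic_field {d : ℕ} {W : Set (ℝ × Ell2)} (hW : IsSubmanifold d W)
    {v₀ : ℝ × Ell2 → ℝ × Ell2} (hv₀ : Differentiable ℝ v₀)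
    (hv₀t : ∀ x ∈ W, v₀ x ∈ tangentSpace W x) {κ : ℝ × Ell2 → ℝ} (hκ : Differentiable ℝ κ)
    {K : Set (ℝ × Ell2)} (hK : IsCompact K) (hKW : K ⊆ W) (hκK : ∀ x ∈ W, κ x ≠ 0 → x ∈ K) :
    ∃ v : ℝ × Ell2 → ℝ × Ell2, Differentiable ℝ v ∧ (∀ x ∈ W, v x ∈ tangentSpace W x) ∧
      (∀ x, κ x = 0 → v x = v₀ x) ∧ {x ∈ W | κ x ≠ 0 ∧ v x = 0}.Countable := by
  classical
  have key : ∀ p : K, ∃ (e : OpenPartialHomeomorph (ℝ × Ell2) (ℝ × Ell2))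
      (L : Submodule ℝ (ℝ × Ell2)) (β : ℝ × Ell2 → ℝ), IsAdaptedChart d W e L ∧
      Differentiable ℝ β ∧ β p ≠ 0 ∧ tsupport β ⊆ e.source := by
    intro p
    obtain ⟨e, L, hpe, he⟩ := hW.exists_chart (hKW p.2)
    obtain ⟨β, h1, h2, h3⟩ := exists_bump e.open_source hpe
    exact ⟨e, L, β, he, h1, h2, h3⟩
  choose e L β he hβ hβp hβs using key
  have step : ∀ t : Finset K, ∃ v : ℝ × Ell2 → ℝ × Ell2, Differentiable ℝ v ∧
      (∀ x ∈ W, v x ∈ tangentSpace W x) ∧ (∀ x, κ x = 0 → v x = v₀ x) ∧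
      {x ∈ W | κ x ≠ 0 ∧ (∃ p ∈ t, β p x ≠ 0) ∧ v x = 0}.Countable := by
    intro t
    induction t using Finset.induction_on with
    | empty => exact ⟨v₀, hv₀, hv₀t, fun _ _ => rfl, by simp⟩
    | insert p t hp ih =>
      obtain ⟨v, hv, hvt, hvκ, hvc⟩ := ih
      obtain ⟨w, hw, hwt, hwρ, hwc⟩ := (he p).exists_perturbation hv hvt (hκ.mul (hβ p))
        ((tsupport_mul_subset_right).trans (hβs p))
      refine ⟨w, hw, hwt, fun x hx => ?_, (hwc.union hvc).mono ?_⟩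
      · rw [hwρ x (by simp [hx]), hvκ x hx]
      · rintro x ⟨hxW, hxκ, ⟨q, hq, hqx⟩, hwx⟩
        by_cases h : β p x = 0
        · right
          rw [hwρ x (by simp [h])] at hwx
          rcases Finset.mem_insert.1 hq with rfl | hq
          · exact absurd h hqx
          · exact ⟨hxW, hxκ, ⟨q, hq, hqx⟩, hwx⟩
        · left
          exact ⟨hxW, mul_ne_zero hxκ h, hwx⟩
  obtain ⟨t, ht⟩ := hK.elim_finite_subcover (fun p : K => {x | β p x ≠ 0})
    (fun p => isOpen_ne.preimage (hβ p).continuous) fun x hx => mem_iUnion.2 ⟨⟨x, hx⟩, hβp ⟨x, hx⟩⟩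
  obtain ⟨v, hv, hvt, hvκ, hvc⟩ := step t
  refine ⟨v, hv, hvt, hvκ, hvc.mono ?_⟩
  rintro x ⟨hxW, hxκ, hvx⟩
  obtain ⟨p, hp, hpx⟩ := mem_iUnion₂.1 (ht (hκK x hxW hxκ))
  exact ⟨hxW, hxκ, ⟨p, hp, hpx⟩, hvx⟩

theorem IsSubmanifold.exists_collared_field {d : ℕ} {W : Set (ℝ × Ell2)} (hW : IsSubmanifold d W)
    {t η : ℝ} (hη : 0 < η) (hηt : 4 * η ≤ t) (hK : IsCompact (W ∩ {x | x.1 ∈ Icc η (t - η)}))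
    (hcol : ∀ x ∈ W, x.1 < 2 * η ∨ t - 2 * η < x.1 → ((1 : ℝ), (0 : Ell2)) ∈ tangentSpace W x) :
    ∃ v : ℝ × Ell2 → ℝ × Ell2, Continuous v ∧ (∀ x ∈ W, v x ∈ tangentSpace W x) ∧
      (∀ x, x.1 < η ∨ t - η < x.1 → v x = (1, 0)) ∧ {x ∈ W | v x = 0}.Countable := by
  have hst : Differentiable ℝ Real.smoothTransition :=
    (Real.smoothTransition.contDiff (n := 1)).differentiable (by simp)
  -- `χ` is 1 within `η` of the ends and 0 at distance at least `2 * η` inside, so `χ • (1, 0)` is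
  -- nonzero only where `W` is assumed to have `(1, 0)` as a tangent vector. The bound `4 * η ≤ t`
  -- keeps the two summands from overlapping.
  let χ : ℝ × Ell2 → ℝ := fun x =>
    Real.smoothTransition (2 - x.1 / η) + Real.smoothTransition (2 - (t - x.1) / η)
  have hχ : Differentiable ℝ χ :=
    (hst.comp (by fun_prop)).add (hst.comp (by fun_prop))
  let κ : ℝ × Ell2 → ℝ := fun x =>
    Real.smoothTransition (x.1 - η) * Real.smoothTransition (t - η - x.1)
  have hκ : Differentiable ℝ κ :=
    (hst.comp (by fun_prop)).mul (hst.comp (by fun_prop))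
  have hκ0 : ∀ x, κ x = 0 ↔ x.1 ≤ η ∨ t - η ≤ x.1 := by
    intro x
    simp only [κ, mul_eq_zero, Real.smoothTransition.zero_iff_nonpos, sub_nonpos]
  have hχ1 : ∀ x, x.1 ≤ η ∨ t - η ≤ x.1 → χ x = 1 := by
    rintro x (hx | hx)
    · have h1 : (1 : ℝ) ≤ 2 - x.1 / η := by
        have := (div_le_one hη).2 hx
        linarith
      have h2 : 2 - (t - x.1) / η ≤ 0 := by
        have := (le_div_iff₀ hη).2 (show 2 * η ≤ t - x.1 by linarith)
        linarith
      simp only [χ, Real.smoothTransition.one_of_one_le h1,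
        Real.smoothTransition.zero_of_nonpos h2, add_zero]
    · have h1 : (1 : ℝ) ≤ 2 - (t - x.1) / η := by
        have := (div_le_one hη).2 (show t - x.1 ≤ η by linarith)
        linarith
      have h2 : 2 - x.1 / η ≤ 0 := by
        have := (le_div_iff₀ hη).2 (show 2 * η ≤ x.1 by linarith)
        linarith
      simp only [χ, Real.smoothTransition.one_of_one_le h1,
        Real.smoothTransition.zero_of_nonpos h2, zero_add]
  have hχ0 : ∀ x : ℝ × Ell2, 2 * η ≤ x.1 → x.1 ≤ t - 2 * η → χ x = 0 := by
    intro x h1 h2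
    have h3 : 2 - (t - x.1) / η ≤ 0 := by
      have := (le_div_iff₀ hη).2 (show 2 * η ≤ t - x.1 by linarith)
      linarith
    have h4 : 2 - x.1 / η ≤ 0 := by
      have := (le_div_iff₀ hη).2 h1
      linarith
    simp only [χ, Real.smoothTransition.zero_of_nonpos h3,
        Real.smoothTransition.zero_of_nonpos h4, zero_add]
  obtain ⟨v, hv, hvt, hvκ, hvc⟩ := hW.exists_generic_field
    (v₀ := fun x => χ x • ((1 : ℝ), (0 : Ell2))) (hχ.smul_const _) (fun x hx => by
      by_cases h : x.1 < 2 * η ∨ t - 2 * η < x.1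
      · exact Submodule.smul_mem _ _ (hcol x hx h)
      · push Not at h
        rw [hχ0 x h.1 h.2, zero_smul]
        exact Submodule.zero_mem _) hκ hK inter_subset_left (fun x hx hκx => by
      rw [Ne, hκ0] at hκx
      push Not at hκx
      exact ⟨hx, hκx.1.le, hκx.2.le⟩)
  have hv1 : ∀ x, x.1 ≤ η ∨ t - η ≤ x.1 → v x = (1, 0) := fun x hx => by
    rw [hvκ x ((hκ0 x).2 hx), hχ1 x hx, one_smul]
  refine ⟨v, hv.continuous, hvt, fun x hx => hv1 x (hx.imp le_of_lt le_of_lt), hvc.mono ?_⟩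
  rintro x ⟨hxW, hvx⟩
  refine ⟨hxW, fun h => ?_, hvx⟩
  rw [hv1 x ((hκ0 x).1 h)] at hvx
  exact one_ne_zero (congrArg Prod.fst hvx)

end VectorFields

/-! ### Reflecting a `θ`-structure in a tangent vector field -/

section Reflecting

/-- A countable compact set is covered by finitely many disjoint open sets, each as small as one
wishes. -/
theorem exists_disjoint_cover {E : Type*} [MetricSpace E] {Z : Set E} (hZ : IsCompact Z)
    (hZc : Z.Countable) {U : E → Set E} (hU : ∀ p ∈ Z, IsOpen (U p) ∧ p ∈ U p) :
    ∃ (n : ℕ) (q : Fin n → E) (O : Fin n → Set E),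
      (∀ i, q i ∈ Z ∧ IsOpen (O i) ∧ O i ⊆ U (q i)) ∧ Z ⊆ ⋃ i, O i ∧
      ∀ i j x, x ∈ O i → x ∈ O j → i = j := by
  classical
  -- The distances from `p` to points of the countable set `Z` are countable in number, so a radius
  -- can avoid them and the bounding sphere misses `Z`.
  have key : ∀ p : Z, ∃ δ > 0, Metric.ball (p : E) δ ⊆ U p ∧ ∀ z ∈ Z, dist z p ≠ δ := by
    intro p
    obtain ⟨R, hR, hball⟩ := Metric.isOpen_iff.1 (hU p p.2).1 p (hU p p.2).2
    have hc : ((fun z => dist z (p : E)) '' Z).Countable := hZc.image _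
    obtain ⟨δ, hδ, hδ'⟩ := (hc.dense_compl ℝ).exists_between hR
    exact ⟨δ, hδ'.1, (Metric.ball_subset_ball hδ'.2.le).trans hball,
      fun z hz h => hδ ⟨z, hz, h⟩⟩
  choose δ hδ hδU hδZ using key
  obtain ⟨t, ht⟩ := hZ.elim_finite_subcover (fun p : Z => Metric.ball (p : E) (δ p))
    (fun p => Metric.isOpen_ball) fun x hx => mem_iUnion.2 ⟨⟨x, hx⟩, Metric.mem_ball_self (hδ _)⟩
  let q : Fin t.card → Z := fun i => (t.equivFin.symm i : Z)
  -- Each ball minus the earlier closed balls: these sets are open and disjoint, and no point of `Z`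
  -- is lost because none lies on a bounding sphere.
  refine ⟨t.card, fun i => q i,
    fun i => Metric.ball (q i : E) (δ (q i)) ∩ ⋂ j : Fin t.card, {x | j < i → δ (q j) < dist x (q j)},
    fun i => ⟨(q i).2, ?_, inter_subset_left.trans (hδU _)⟩, fun x hx => ?_, ?_⟩
  · refine Metric.isOpen_ball.inter (isOpen_iInter_of_finite fun j => ?_)
    by_cases hji : j < i
    · simp only [hji, true_imp_iff]
      exact isOpen_lt continuous_const (by fun_prop)
    · simp [hji]
  · have hex : ∃ i : Fin t.card, x ∈ Metric.ball (q i : E) (δ (q i)) := by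
      obtain ⟨p, hp, hpx⟩ := mem_iUnion₂.1 (ht hx)
      exact ⟨t.equivFin ⟨p, hp⟩, by simpa [q] using hpx⟩
    obtain ⟨i, hi, hmin⟩ := WellFounded.has_min (wellFounded_lt (α := Fin t.card))
      {i | x ∈ Metric.ball (q i : E) (δ (q i))} hex
    refine mem_iUnion.2 ⟨i, hi, mem_iInter.2 fun j hji => ?_⟩
    have h1 : ¬ dist x (q j) < δ (q j) := fun h => hmin j h hji
    exact lt_of_le_of_ne (not_lt.1 h1) (hδZ (q j) x hx).symm
  · rintro i j x ⟨hi, hi'⟩ ⟨hj, hj'⟩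
    rcases lt_trichotomy i j with h | h | h
    · exact absurd (mem_iInter.1 hj' i h) (not_lt.2 (le_of_lt hi))
    · exact h
    · exact absurd (mem_iInter.1 hi' j h) (not_lt.2 (le_of_lt hj))

variable {X : Type*}

/-- Translates matrix reflections of frames into reflections of tangent vectors. The scale `r` drops
out because a reflection depends only on the line of its vector. -/
theorem frameMap_frameRefl {P : Submodule ℝ (ℝ × Ell2)} {v₁ v₂ : ℝ × Ell2}
    (h : IsOrthonormalFrame P v₁ v₂) {v u : ℝ × Ell2} (hv : v ∈ P) (hv0 : v ≠ 0) (hu : u ∈ P)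
    {r : ℝ} (hr : r ≠ 0) (b : X) (g : (ℝ × Ell2) →ₗ[ℝ] Ell2) :
    frameMap v₁ v₂ (frameRefl (b, g v₁, g v₂) (r * ip v v₁, r * ip v v₂)) u =
      g (reflect v u) := by
  have hvv : ip v v = ip v v₁ ^ 2 + ip v v₂ ^ 2 := by
    conv_lhs => rw [h.eq v hv]
    have h21 : ip v₂ v₁ = 0 := by rw [ip_comm, h.ip₁₂]
    simp only [ip_add_left, ip_add_right, ip_smul_left, ip_smul_right, h.ip₁₁, h.ip₂₂, h.ip₁₂, h21]
    ring
  have huv : ip u v = ip u v₁ * ip v v₁ + ip u v₂ * ip v v₂ := by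
    conv_lhs => rw [h.eq v hv]
    simp only [ip_add_right, ip_smul_right]
    ring
  have hpos := ip_self_pos hv0
  rw [hvv] at hpos
  have hg : g (reflect v u) = (ip u v₁ - 2 * ip u v / ip v v * ip v v₁) • g v₁ +
      (ip u v₂ - 2 * ip u v / ip v v * ip v v₂) • g v₂ := by
    have : reflect v u = (ip u v₁ - 2 * ip u v / ip v v * ip v v₁) • v₁ +
      (ip u v₂ - 2 * ip u v / ip v v * ip v v₂) • v₂ := by
      rw [reflect_apply]
      nth_rw 1 [h.eq u hu]
      nth_rw 4 [h.eq v hv]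
      module
    rw [this, map_add, map_smul, map_smul]
  rw [hg, frameMap_apply, frameRefl, frameMul, huv, hvv]
  have hn : (r * ip v v₁) ^ 2 + (r * ip v v₂) ^ 2 = r ^ 2 * (ip v v₁ ^ 2 + ip v v₂ ^ 2) := by ring
  simp only [hn]
  have h0 := hpos.ne'
  match_scalars <;> field_simp <;> ring

variable [TopologicalSpace X] {θ : C(X, BO 2)}

/-- Contracting a neighbourhood to `p` joins the frame at each `x` to the fixed frame at `p`, so the
filling at `p` spreads to fillings `G (x, ·)` continuous in `x`. -/
theorem IsBundleData.exists_local_extension {W : Set (ℝ × Ell2)} (hW : IsSubmanifold 2 W)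
    {b : ℝ × Ell2 → X} {g : ℝ × Ell2 → (ℝ × Ell2) →ₗ[ℝ] Ell2}
    (h : IsBundleData θ W (tangentSpace W) b g) (hN : ∀ f ∈ frameSet θ, ReflLoopNull θ f)
    {p : ℝ × Ell2} (hp : p ∈ W) :
    ∃ (U : Set (ℝ × Ell2)) (v₁ v₂ : ℝ × Ell2 → ℝ × Ell2)
      (G : (ℝ × Ell2) × (ℝ × ℝ) → X × Ell2 × Ell2) (r : ℝ),
      IsOpen U ∧ p ∈ U ∧ ContinuousOn v₁ (W ∩ U) ∧ ContinuousOn v₂ (W ∩ U) ∧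
      (∀ x ∈ W ∩ U, IsOrthonormalFrame (tangentSpace W x) (v₁ x) (v₂ x)) ∧
      ContinuousOn G ((W ∩ U) ×ˢ univ) ∧ (∀ z ∈ (W ∩ U) ×ˢ univ, G z ∈ frameSet θ) ∧ 0 < r ∧
      ∀ y ∈ W ∩ U, ∀ w : ℝ × ℝ, r ≤ w.1 ^ 2 + w.2 ^ 2 →
        G (y, w) = frameRefl (b y, g y (v₁ y), g y (v₂ y)) w := by
  obtain ⟨U, v₁, v₂, c, hU, hpU, hv₁, hv₂, hv, hc, hcm, hc01⟩ := hW.exists_frame_contraction hp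
  have hcont : ContinuousOn (fun x => ((b x, g x (v₁ x), g x (v₂ x)) : X × Ell2 × Ell2)) (W ∩ U) := by
    refine (h.cont_base.mono inter_subset_left).prodMk (.prodMk ?_ ?_)
    · exact h.cont_fibre.comp (continuousOn_id.prodMk hv₁) fun x hx => ⟨hx.1, (hv x hx).mem₁⟩
    · exact h.cont_fibre.comp (continuousOn_id.prodMk hv₂) fun x hx => ⟨hx.1, (hv x hx).mem₂⟩
  have hmem : ∀ x ∈ W ∩ U, ((b x, g x (v₁ x), g x (v₂ x)) : X × Ell2 × Ell2) ∈ frameSet θ := by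
    intro x hx
    have hx' := hv x hx
    refine ⟨h.mem x hx.1 _ hx'.mem₁, h.mem x hx.1 _ hx'.mem₂, fun s t hst => ?_⟩
    have h0 := h.inj x hx.1 (s • v₁ x + t • v₂ x)
      (Submodule.add_mem _ (Submodule.smul_mem _ _ hx'.mem₁) (Submodule.smul_mem _ _ hx'.mem₂))
      (by rw [map_add, map_smul, map_smul]; exact hst)
    have e1 := congrArg (fun u => ip u (v₁ x)) h0
    have e2 := congrArg (fun u => ip u (v₂ x)) h0
    have h21 : ip (v₂ x) (v₁ x) = 0 := by rw [ip_comm, hx'.ip₁₂]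
    simp only [ip_add_left, ip_smul_left, hx'.ip₁₁, hx'.ip₂₂, hx'.ip₁₂, h21] at e1 e2
    simp [ip] at e1 e2
    exact ⟨e1, e2⟩
  obtain ⟨G, r, hr, hG, hGm, hGr⟩ := (hN _ (hmem p ⟨hp, hpU⟩)).extend (Y := ℝ × Ell2)
    (s := W ∩ U) (F := fun z => (b (c z), g (c z) (v₁ (c z)), g (c z) (v₂ (c z))))
    (hcont.comp hc hcm) (fun z hz => hmem _ (hcm hz)) (fun y hy => by simp only [(hc01 y hy).1])
  refine ⟨U, v₁, v₂, G, r, hU, hpU, hv₁, hv₂, hv, hG, hGm, hr, fun y hy w hw => ?_⟩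
  rw [hGr y hy w hw, (hc01 y hy).2]

/-- If reflection loops are null-homotopic, then a `θ`-structure on a surface may be changed so that
it becomes reflected in the nonvanishing vector `n₀` outside a compact set, provided that `n₀`
extends to a tangent vector field with countably many zeros. -/
theorem IsBundleData.exists_reflect {W : Set (ℝ × Ell2)} (hW : IsSubmanifold 2 W)
    {b : ℝ × Ell2 → X} {g : ℝ × Ell2 → (ℝ × Ell2) →ₗ[ℝ] Ell2}
    (h : IsBundleData θ W (tangentSpace W) b g) (hN : ∀ f ∈ frameSet θ, ReflLoopNull θ f)
    {v : ℝ × Ell2 → ℝ × Ell2} (hv : Continuous v) (hvt : ∀ x ∈ W, v x ∈ tangentSpace W x)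
    {K : Set (ℝ × Ell2)} (hK : IsCompact K) (hKW : K ⊆ W) (hZ : {x ∈ W | v x = 0}.Countable)
    {n₀ : ℝ × Ell2} (hn₀ : n₀ ≠ 0) (hout : ∀ x ∈ W \ K, v x = n₀) :
    ∃ (b' : ℝ × Ell2 → X) (g' : ℝ × Ell2 → (ℝ × Ell2) →ₗ[ℝ] Ell2),
      IsBundleData θ W (tangentSpace W) b' g' ∧
      ∀ x ∈ W \ K, b' x = b x ∧ ∀ u ∈ tangentSpace W x, g' x u = g x (reflect n₀ u) := by
  classical
  have : Nonempty X := ⟨b 0⟩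
  have hloc := fun p : ℝ × Ell2 => fun hp : p ∈ W => h.exists_local_extension hW hN hp
  choose! U v₁ v₂ G r hU hpU hv₁ hv₂ hvf hG hGm hr hGr using hloc
  set Z := {x ∈ W | v x = 0} with hZdef
  have hZK : Z = K ∩ {x | v x = 0} := by
    ext x
    refine ⟨fun hx => ⟨?_, hx.2⟩, fun hx => ⟨hKW hx.1, hx.2⟩⟩
    by_contra hxK
    exact hn₀ ((hout x ⟨hx.1, hxK⟩).symm.trans hx.2)
  have hZc : IsCompact Z := by
    rw [hZK]
    exact hK.inter_right (isClosed_eq hv continuous_const)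
  obtain ⟨n, q, O, hqO, hZO, hdis⟩ := exists_disjoint_cover hZc hZ
    (U := U) fun p hp => ⟨hU p hp.1, hpU p hp.1⟩
  have hqW : ∀ i, q i ∈ W := fun i => (hqO i).1.1
  have hC : IsCompact (K \ ⋃ i, O i) := hK.diff (isOpen_iUnion fun i => (hqO i).2.1)
  have hvv : Continuous fun x => ip (v x) (v x) := continuous_ip.comp (hv.prodMk hv)
  obtain ⟨m₁, hm₁, hm₁'⟩ := hC.exists_forall_le' (f := fun x => ip (v x) (v x))
    hvv.continuousOn (a := 0) fun x hx => ip_self_pos fun h0 =>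
      hx.2 (hZO ⟨hKW hx.1, h0⟩)
  obtain ⟨R, hR, hRr⟩ : ∃ R : ℝ, 0 < R ∧ ∀ i, r (q i) < R := by
    refine ⟨∑ i, r (q i) + 1, ?_, fun i => ?_⟩
    · have := Finset.sum_nonneg fun i (_ : i ∈ Finset.univ) => (hr _ (hqW i)).le
      linarith
    · have := Finset.single_le_sum (fun i (_ : i ∈ Finset.univ) => (hr _ (hqW i)).le)
        (Finset.mem_univ i)
      linarith
  -- By compactness `v` is bounded away from zero on `K` minus the sets `O i`. Multiplying by `l`
  -- pushes it, and `n₀` too, outside the discs on which the fillings differ from reflections.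
  obtain ⟨l, hl0, hlC, hln⟩ : ∃ l : ℝ, 0 < l ∧
      (∀ x ∈ K \ ⋃ i, O i, R < l ^ 2 * ip (v x) (v x)) ∧ R < l ^ 2 * ip n₀ n₀ := by
    have hm : 0 < min m₁ (ip n₀ n₀) := lt_min hm₁ (ip_self_pos hn₀)
    have hpos : 0 < (R + 1) / min m₁ (ip n₀ n₀) := by positivity
    have hmul : ∀ s, min m₁ (ip n₀ n₀) ≤ s →
        R < √((R + 1) / min m₁ (ip n₀ n₀)) ^ 2 * s := fun s hs => by
      rw [Real.sq_sqrt hpos.le]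
      calc R < R + 1 := by linarith
        _ = (R + 1) / min m₁ (ip n₀ n₀) * min m₁ (ip n₀ n₀) := (div_mul_cancel₀ _ hm.ne').symm
        _ ≤ _ := mul_le_mul_of_nonneg_left hs hpos.le
    exact ⟨_, Real.sqrt_pos.2 hpos, fun x hx => hmul _ ((min_le_left _ _).trans (hm₁' x hx)),
      hmul _ (min_le_right _ _)⟩
  have hlv : ∀ x ∈ W, x ∉ ⋃ i, O i → R < l ^ 2 * ip (v x) (v x) := by
    intro x hx hxO
    by_cases hxK : x ∈ K
    · exact hlC x ⟨hxK, hxO⟩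
    · rw [hout x ⟨hx, hxK⟩]
      exact hln
  -- The filling evaluated at the coordinates of `l • v`, hence defined also at zeros of `v`.
  let A : Fin n → ℝ × Ell2 → X × Ell2 × Ell2 := fun i x =>
    G (q i) (x, (l * ip (v x) (v₁ (q i) x), l * ip (v x) (v₂ (q i) x)))
  let b' : ℝ × Ell2 → X := fun x =>
    if hx : ∃ i, x ∈ O i then (A hx.choose x).1 else b x
  let g' : ℝ × Ell2 → (ℝ × Ell2) →ₗ[ℝ] Ell2 := fun x =>
    if hx : ∃ i, x ∈ O i then
      frameMap (v₁ (q hx.choose) x) (v₂ (q hx.choose) x) (A hx.choose x)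
    else g x ∘ₗ reflect (v x)
  have hin : ∀ i x, x ∈ O i → b' x = (A i x).1 ∧
      g' x = frameMap (v₁ (q i) x) (v₂ (q i) x) (A i x) := by
    intro i x hx
    have hex : ∃ i, x ∈ O i := ⟨i, hx⟩
    have hi : hex.choose = i := hdis _ _ x hex.choose_spec hx
    simp only [b', g', dif_pos hex, hi, and_self]
  have hnotin : ∀ x, x ∉ ⋃ i, O i → b' x = b x ∧ g' x = g x ∘ₗ reflect (v x) := by
    intro x hx
    have hex : ¬ ∃ i, x ∈ O i := fun h => hx (mem_iUnion.2 h)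
    simp only [b', g', dif_neg hex, and_self]
  have hsub : ∀ i, W ∩ O i ⊆ W ∩ U (q i) := fun i => inter_subset_inter_right _ (hqO i).2.2
  -- Wherever `l • v` is long, both definitions give the reflection in `v`. This region is open and
  -- contains every point of `W` outside the `O i`, so no continuity problem arises at their
  -- boundaries.
  have hbig : ∀ x ∈ W, R < l ^ 2 * ip (v x) (v x) →
      b' x = b x ∧ ∀ u ∈ tangentSpace W x, g' x u = g x (reflect (v x) u) := by
    intro x hx hxR
    by_cases hxO : x ∈ ⋃ i, O i
    · obtain ⟨i, hi⟩ := mem_iUnion.1 hxO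
      have hxU := hsub i ⟨hx, hi⟩
      have hfr := hvf _ (hqW i) x hxU
      have hv0 : v x ≠ 0 := by
        intro h0
        rw [h0] at hxR
        simp only [ip, Prod.fst_zero, Prod.snd_zero, inner_zero_left] at hxR
        linarith
      have hsq : ip (v x) (v x) = ip (v x) (v₁ (q i) x) ^ 2 + ip (v x) (v₂ (q i) x) ^ 2 := by
        conv_lhs => arg 2; rw [hfr.eq _ (hvt x hx)]
        simp only [ip_add_right, ip_smul_right]
        ring
      have hA : A i x = frameRefl (b x, g x (v₁ (q i) x), g x (v₂ (q i) x))
          (l * ip (v x) (v₁ (q i) x), l * ip (v x) (v₂ (q i) x)) := by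
        refine hGr _ (hqW i) x hxU _ ?_
        have := hRr i
        rw [hsq] at hxR
        dsimp only
        nlinarith
      rw [(hin i x hi).1, (hin i x hi).2, hA]
      exact ⟨rfl, fun u hu => frameMap_frameRefl hfr (hvt x hx) hv0 hu hl0.ne' _ _⟩
    · rw [(hnotin x hxO).1, (hnotin x hxO).2]
      exact ⟨rfl, fun u _ => rfl⟩
  refine ⟨b', g', IsBundleData.of_local fun x hx => ?_, fun x hx => ?_⟩
  · by_cases hxO : x ∈ ⋃ i, O i
    · obtain ⟨i, hi⟩ := mem_iUnion.1 hxO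
      have c₁ := (hv₁ _ (hqW i)).mono (hsub i)
      have c₂ := (hv₂ _ (hqW i)).mono (hsub i)
      have cA : ContinuousOn (A i) (W ∩ O i) := by
        refine (hG _ (hqW i)).comp (continuousOn_id.prodMk (.prodMk ?_ ?_))
          fun y hy => ⟨hsub i hy, trivial⟩
        · exact continuousOn_const.mul (hv.continuousOn.ip c₁)
        · exact continuousOn_const.mul (hv.continuousOn.ip c₂)
      refine ⟨O i, _, _, (hqO i).2.1, hi, IsBundleData.of_frame c₁ c₂
        (fun y hy => hvf _ (hqW i) y (hsub i hy)) cA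
        (fun y hy => hGm _ (hqW i) _ ⟨hsub i hy, trivial⟩), fun y hy => ?_⟩
      rw [(hin i y hy.2).1, (hin i y hy.2).2]
      exact ⟨rfl, fun u _ => rfl⟩
    · refine ⟨{y | R < l ^ 2 * ip (v y) (v y)}, b, fun y => g y ∘ₗ reflect (v y),
        isOpen_lt continuous_const (continuous_const.mul hvv), hlv x hx hxO, ?_,
        fun y hy => hbig y hy.1 hy.2⟩
      have hv0 : ∀ y, R < l ^ 2 * ip (v y) (v y) → ip (v y) (v y) ≠ 0 := by
        intro y hy h0
        rw [h0] at hy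
        linarith
      refine h.pullback (φ := id) continuousOn_id inter_subset_left ?_ ?_ ?_
      · simp only [reflect_apply]
        have e1 : ContinuousOn (fun p : (ℝ × Ell2) × (ℝ × Ell2) => v p.1)
            {p | p.1 ∈ W ∩ {y | R < l ^ 2 * ip (v y) (v y)} ∧ p.2 ∈ tangentSpace W p.1} :=
          (hv.comp continuous_fst).continuousOn
        exact continuousOn_snd.sub (((continuousOn_const.mul (continuousOn_snd.ip e1)).div
          (e1.ip e1) fun p hp => hv0 _ hp.1.2).smul e1)
      · intro y hy u hu
        rw [reflect_apply]
        exact Submodule.sub_mem _ hu (Submodule.smul_mem _ _ (hvt y hy.1))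
      · intro y hy u hu h0
        have hvy : v y ≠ 0 := fun hvy => hv0 y hy.2 (by simp [hvy, ip])
        rw [← reflect_reflect hvy u, h0, map_zero]
  · have h1 := hbig x hx.1 (by rw [hout x hx]; exact hln)
    rw [hout x hx] at h1
    exact h1

end Reflecting

/-! ### Submanifolds under affine maps and gluing -/

section Submanifolds

variable {E : Type*} [NormedAddCommGroup E] [NormedSpace ℝ E]

theorem tangentSpace_mapsTo {F : Type*} [NormedAddCommGroup F] [NormedSpace ℝ F] {M : Set E}
    {N : Set F} {f : E → F} {f' : E →L[ℝ] F} {x : E} (hf : HasFDerivAt f f' x)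
    (hM : ∀ᶠ y in 𝓝 x, y ∈ M → f y ∈ N) {u : E} (hu : u ∈ tangentSpace M x) :
    f' u ∈ tangentSpace N (f x) := by
  suffices tangentSpace M x ≤ (tangentSpace N (f x)).comap f'.toLinearMap from this hu
  refine Submodule.span_le.2 fun u hu => Submodule.subset_span ?_
  rw [← tangentConeAt_inter_nhds hM] at hu
  refine tangentConeAt_mono ?_ (hf.hasFDerivWithinAt.mapsTo_tangent_cone hu)
  rintro _ ⟨y, ⟨hy, hy'⟩, rfl⟩
  exact hy' hy

theorem tangentSpace_eq_of_inter_eq {M N O : Set E} {x : E} (hO : O ∈ 𝓝 x)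
    (h : M ∩ O = N ∩ O) : tangentSpace M x = tangentSpace N x := by
  unfold tangentSpace
  rw [← tangentConeAt_inter_nhds hO, h, tangentConeAt_inter_nhds hO]

theorem mem_tangentSpace_preimage_iff {φ : E → E} {a : E} {D : E ≃L[ℝ] E}
    (hφ : ∀ x, φ x = a + D x) {M : Set E} {x u : E} :
    u ∈ tangentSpace (φ ⁻¹' M) x ↔ D u ∈ tangentSpace M (φ x) := by
  have h1 : HasFDerivAt φ (D : E →L[ℝ] E) x := by
    rw [funext hφ]
    exact D.hasFDerivAt.const_add a
  have h2 : HasFDerivAt (fun y => D.symm (y - a)) (D.symm : E →L[ℝ] E) (φ x) :=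
    D.symm.hasFDerivAt.comp (φ x) ((hasFDerivAt_id _).sub_const a)
  have h3 : ∀ y, D.symm (φ y - a) = y := fun y => by simp [hφ]
  constructor
  · exact fun hu => tangentSpace_mapsTo h1 (Filter.Eventually.of_forall fun y hy => hy) hu
  · intro hu
    have := tangentSpace_mapsTo (N := φ ⁻¹' M) h2 (Filter.Eventually.of_forall fun y hy => by
      rw [mem_preimage, hφ]
      simpa using hy) hu
    simpa [h3] using this

theorem IsSubmanifold.preimage {φ : E → E} {a : E} {D : E ≃L[ℝ] E} (hφ : ∀ x, φ x = a + D x)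
    {d : ℕ} {M : Set E} (hM : IsSubmanifold d M) : IsSubmanifold d (φ ⁻¹' M) := by
  intro x hx
  obtain ⟨e, L, hxe, h1, h2, h3, h4, h5⟩ := hM (φ x) hx
  let Φ : E ≃ₜ E := D.toHomeomorph.trans (Homeomorph.addLeft a)
  have hΦ : ∀ y, Φ y = φ y := fun y => (hφ y).symm
  have hΦs : ∀ y, Φ.symm y = D.symm (-a + y) := fun y => rfl
  refine ⟨Φ.toOpenPartialHomeomorph.trans e, L, ?_, ?_, ?_, h3, h4, ?_⟩
  · simpa [hΦ] using hxe
  · have hc : ContDiffOn ℝ ∞ φ univ := by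
      rw [funext hφ]
      exact (contDiff_const.add D.contDiff).contDiffOn
    have : ContDiffOn ℝ ∞ (e ∘ φ) (φ ⁻¹' e.source) := h1.comp (hc.mono (subset_univ _)) fun y hy => hy
    refine (this.congr fun y hy => by simp [hΦ]).mono fun y hy => ?_
    simpa [hΦ] using hy
  · have hc : ContDiff ℝ ∞ (fun y => D.symm (-a + y)) :=
      D.symm.contDiff.comp (contDiff_const.add contDiff_id)
    have : ContDiffOn ℝ ∞ ((fun y => D.symm (-a + y)) ∘ e.symm) e.target := hc.comp_contDiffOn h2
    refine (this.congr fun y hy => by simp [hΦs]).mono fun y hy => ?_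
    simpa using hy
  · intro y hy
    have hy' : φ y ∈ e.source := by simpa [hΦ] using hy
    rw [mem_preimage, h5 _ hy']
    simp [hΦ]

theorem IsSubmanifold.of_local {d : ℕ} {M : Set E}
    (h : ∀ x ∈ M, ∃ O N : Set E, IsOpen O ∧ x ∈ O ∧ IsSubmanifold d N ∧ M ∩ O = N ∩ O) :
    IsSubmanifold d M := by
  intro x hx
  obtain ⟨O, N, hO, hxO, hN, heq⟩ := h x hx
  have hxN : x ∈ N := (heq.subset ⟨hx, hxO⟩).1
  obtain ⟨e, L, hxe, h1, h2, h3, h4, h5⟩ := hN x hxN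
  refine ⟨e.restrOpen O hO, L, ?_, ?_, ?_, h3, h4, ?_⟩
  · rw [e.restrOpen_source]
    exact ⟨hxe, hxO⟩
  · rw [e.restrOpen_source]
    exact h1.mono inter_subset_left
  · exact h2.mono fun y hy => hy.1
  · intro y hy
    rw [e.restrOpen_source] at hy
    have : y ∈ M ↔ y ∈ N := ⟨fun hM => (heq.subset ⟨hM, hy.2⟩).1, fun hM => (heq.superset ⟨hM, hy.2⟩).1⟩
    rw [this]
    exact h5 y hy.1

/-- Lying in some `ℝⁿ` is essential, as bounded closed sets of `ℓ²` need not be compact: the slab is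
a closed part of the image of a finite-dimensional box. -/
theorem isCompact_slab {W : Set (ℝ × Ell2)} (hW : IsClosed W)
    (hsub : ∃ n, ∀ p ∈ W, p.2 ∈ stdSubspace n) (hcube : ∀ p ∈ W, ∀ i, p.2 i ∈ Ioo (-1 : ℝ) 1)
    (a b : ℝ) : IsCompact (W ∩ {x | x.1 ∈ Icc a b}) := by
  classical
  obtain ⟨n, hn⟩ := hsub
  let Φ : ℝ × (Fin n → ℝ) → ℝ × Ell2 := fun z =>
    (z.1, ∑ i : Fin n, z.2 i • (lp.single 2 (i : ℕ) (1 : ℝ) : Ell2))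
  have hΦ : Continuous Φ := by
    simp only [Φ]
    fun_prop
  have hc : IsCompact (Φ '' (Icc a b ×ˢ univ.pi fun _ => Icc (-1 : ℝ) 1)) :=
    (isCompact_Icc.prod (isCompact_univ_pi fun _ => isCompact_Icc)).image hΦ
  refine hc.of_isClosed_subset (hW.inter (isClosed_Icc.preimage continuous_fst)) ?_
  rintro x ⟨hxW, hx⟩
  refine ⟨(x.1, fun i => x.2 i), ⟨hx, fun i _ => Ioo_subset_Icc_self (hcube x hxW i)⟩, ?_⟩
  refine Prod.ext rfl ?_
  ext k
  simp only [Φ, lp.coeFn_sum, Finset.sum_apply, lp.coeFn_smul, Pi.smul_apply, smul_eq_mul]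
  by_cases hk : k < n
  · rw [Finset.sum_eq_single (⟨k, hk⟩ : Fin n)]
    · simp
    · intro i _ hi
      have : k ≠ (i : ℕ) := fun h => hi (Fin.ext h.symm)
      simp [lp.single_apply, this]
    · simp
  · rw [hn x hxW k (not_lt.1 hk)]
    refine Finset.sum_eq_zero fun i _ => ?_
    have : k ≠ (i : ℕ) := fun h => hk (h ▸ i.2)
    simp [lp.single_apply, this]

end Submanifolds

/-! ### Reversing and composing morphisms -/

section Category

variable {X : Type*} [TopologicalSpace X] {θ : C(X, BO 2)}

theorem AgreesWithCylinder.mono {W : Set (ℝ × Ell2)} {l : ThetaStructure θ W} {c : Obj θ}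
    {S S' : Set ℝ} (h : AgreesWithCylinder l c S) (hS : S' ⊆ S) : AgreesWithCylinder l c S' :=
  ⟨fun p hp => h.1 p (hS hp), fun p hW hc hp => h.2 p hW hc (hS hp)⟩

theorem AgreesWithCylinder.unit_mem {W : Set (ℝ × Ell2)} {l : ThetaStructure θ W} {c : Obj θ}
    {S : Set ℝ} (h : AgreesWithCylinder l c S) (hS : IsOpen S) {p : ℝ × Ell2} (hp : p ∈ W)
    (hpS : p.1 ∈ S) : ((1 : ℝ), (0 : Ell2)) ∈ tangentSpace W p := by
  refine mem_tangentSpace_of_hasDerivAt (c := fun s : ℝ => p + s • ((1 : ℝ), (0 : Ell2))) ?_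
    (by simp) ?_
  · simpa using ((hasDerivAt_id (0 : ℝ)).smul_const ((1 : ℝ), (0 : Ell2))).const_add p
  · have hc : ContinuousAt (fun s : ℝ => p.1 + s) 0 := by fun_prop
    have : ∀ᶠ s : ℝ in 𝓝 0, p.1 + s ∈ S :=
      hc.eventually_mem (hS.mem_nhds (by simpa using hpS))
    filter_upwards [this] with s hs
    rw [h.1 _ (by simpa using hs)]
    simpa using (h.1 p hpS).1 hp

theorem AgreesWithCylinder.tangentSpace_le {W : Set (ℝ × Ell2)} {l : ThetaStructure θ W} {c : Obj θ}
    {S : Set ℝ} (h : AgreesWithCylinder l c S) (hS : IsOpen S) {p : ℝ × Ell2}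
    (hpS : p.1 ∈ S) {u : ℝ × Ell2} (hu : u ∈ tangentSpace W p) :
    u ∈ (⊤ : Submodule ℝ ℝ).prod (tangentSpace c.carrier p.2) := by
  refine ⟨trivial, ?_⟩
  exact tangentSpace_mapsTo (f := Prod.snd) (f' := ContinuousLinearMap.snd ℝ ℝ Ell2) hasFDerivAt_snd
    (Filter.eventually_of_mem ((hS.preimage continuous_fst).mem_nhds hpS)
      fun y hy hyW => (h.1 y hy).1 hyW) hu

/-- Carries the altered structure through the mirror `φ`, which also provides the diffeomorphism of
underlying cobordisms. -/
theorem Cob.exists_reverse {c₀ c₁ : Obj θ} (w : Cob c₀ c₁)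
    (hN : ∀ f ∈ frameSet θ, ReflLoopNull θ f) [Nonempty X] :
    ∃ w' : Cob c₁ c₀, Diffeomorphic w'.underlying w.underlying := by
  obtain ⟨ε, hε, hcol₀, hcol₁⟩ := w.exists_collar
  have hT := w.length_pos
  set T := w.length with hTdef
  set W := w.carrier with hWdef
  obtain ⟨b, g, hbg, hm⟩ := BundleMap.exists_isBundleData (V := tangentSpace W) w.structureMap
  obtain ⟨η, hη, hηε, hηT⟩ : ∃ η : ℝ, 0 < η ∧ 2 * η ≤ ε ∧ 4 * η ≤ T :=
    ⟨min (ε / 2) (T / 4), by positivity, by linarith [min_le_left (ε / 2) (T / 4)],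
      by linarith [min_le_right (ε / 2) (T / 4)]⟩
  have hK := isCompact_slab w.isClosed w.exists_subset w.mem_cube η (T - η)
  obtain ⟨v, hv, hvt, hvη, hvZ⟩ := w.isSubmanifold.exists_collared_field hη hηT hK
    (fun x hx hx' => by
      rcases hx' with hx' | hx'
      · exact hcol₀.unit_mem isOpen_Iio hx (lt_of_lt_of_le hx' hηε)
      · exact hcol₁.unit_mem isOpen_Ioi hx (lt_of_le_of_lt (by linarith) hx'))
  have hnotK : ∀ x ∈ W, x ∉ W ∩ {x | x.1 ∈ Icc η (T - η)} ↔ x.1 < η ∨ T - η < x.1 := by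
    intro x hx
    simp only [mem_inter_iff, hx, true_and, mem_ofPred_eq, mem_Icc, not_and_or, not_le]
  obtain ⟨b', g', hbg', hr⟩ := hbg.exists_reflect w.isSubmanifold hN hv hvt hK inter_subset_left
    hvZ (n₀ := ((1 : ℝ), (0 : Ell2))) (fun h => one_ne_zero (congrArg Prod.fst h))
    fun x hx => hvη x ((hnotK x hx.1).1 hx.2)
  let φ : ℝ × Ell2 → ℝ × Ell2 := fun p => (T - p.1, p.2)
  let D : (ℝ × Ell2) ≃L[ℝ] (ℝ × Ell2) :=
    (ContinuousLinearEquiv.neg ℝ).prodCongr (ContinuousLinearEquiv.refl ℝ Ell2)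
  have hD : ∀ u, D u = (-u.1, u.2) := fun u => rfl
  have hφ : ∀ p, φ p = (T, 0) + D p := fun p => by
    rw [hD]
    ext <;> simp [φ, sub_eq_add_neg]
  have hφφ : ∀ p, φ (φ p) = p := fun p => by simp [φ]
  have hφc : ContDiff ℝ ∞ φ := (contDiff_const.sub contDiff_fst).prodMk contDiff_snd
  have hsub' : IsSubmanifold 2 (φ ⁻¹' W) := w.isSubmanifold.preimage hφ
  have hdata : IsBundleData θ (φ ⁻¹' W) (tangentSpace (φ ⁻¹' W)) (b' ∘ φ)
      (fun x => g' (φ x) ∘ₗ (D : (ℝ × Ell2) →ₗ[ℝ] (ℝ × Ell2))) := by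
    refine hbg'.pullback hφc.continuous.continuousOn (fun x hx => hx) ?_ ?_ ?_
    · exact (D.continuous.comp continuous_snd).continuousOn
    · exact fun x hx u hu => (mem_tangentSpace_preimage_iff hφ).1 hu
    · exact fun x hx u hu h0 => D.map_eq_zero_iff.1 h0
  obtain ⟨m, hm'⟩ := hdata.exists_bundleMap two_pos fun x hx => hsub'.finrank_tangentSpace hx
  -- The cancellation: `D` is itself the reflection in `(1, 0)`, the vector in which the altered
  -- structure is reflected on the collars.
  have hrefl : ∀ u : ℝ × Ell2, reflect ((1 : ℝ), (0 : Ell2)) (D u) = u := by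
    intro u
    rw [reflect_apply, hD]
    ext
    · simp [ip]; ring
    · simp [ip]
  have agree : ∀ (c : Obj θ) (S S' : Set ℝ), AgreesWithCylinder w.structureMap c S → IsOpen S →
      (∀ s ∈ S', T - s ∈ S ∧ (T - s < η ∨ T - η < T - s)) → AgreesWithCylinder m c S' := by
    intro c S S' hc hS hSS'
    refine ⟨fun p hp => hc.1 (φ p) (hSS' _ hp).1, fun p hpW hpc hpS => ?_⟩
    obtain ⟨h1, h2⟩ := hSS' _ hpS
    have hpW' : φ p ∈ W := hpW
    have hag := hc.2 (φ p) hpW' hpc h1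
    have hrp := hr (φ p) ⟨hpW', (hnotK _ hpW').2 h2⟩
    refine ⟨?_, fun u hu hu' => ?_⟩
    · rw [(hm' p hpW).1, ← hag.1, (hm _ hpW').1]
      exact hrp.1
    · have hDu : D u ∈ tangentSpace W (φ p) := (mem_tangentSpace_preimage_iff hφ).1 hu
      -- The tangent spaces of the cylindrical part contain `(1, 0)` and are therefore stable under
      -- the reflection, so the original structure may be evaluated on `u` itself.
      have hu2 : u ∈ tangentSpace W (φ p) := by
        rw [← hrefl u, reflect_apply]
        exact Submodule.sub_mem _ hDu (Submodule.smul_mem _ _ (hc.unit_mem hS hpW' h1))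
      rw [(hm' p hpW).2 u hu, ← hag.2 u hu2 hu', (hm _ hpW').2 u hu2]
      change g' (φ p) (D u) = _
      rw [hrp.2 _ hDu, hrefl]
  let w' : Cob c₁ c₀ :=
    { length := T
      length_pos := hT
      carrier := φ ⁻¹' W
      isSubmanifold := hsub'
      isClosed := w.isClosed.preimage hφc.continuous
      exists_subset := w.exists_subset.imp fun n hn p hp => hn (φ p) hp
      mem_cube := fun p hp => w.mem_cube (φ p) hp
      structureMap := m
      exists_collar := by
        refine ⟨η, hη, agree c₁ (Ioi (T - ε)) _ hcol₁ isOpen_Ioi fun s hs => ?_,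
          agree c₀ (Iio ε) _ hcol₀ isOpen_Iio fun s hs => ?_⟩
        · rw [mem_Iio] at hs
          exact ⟨by rw [mem_Ioi]; linarith, Or.inr (by linarith)⟩
        · rw [mem_Ioi] at hs
          exact ⟨by rw [mem_Iio]; linarith, Or.inl (by linarith)⟩ }
  refine ⟨w', φ, φ, ?_, ?_, fun x _ => hφφ x, fun x _ => hφφ x,
    fun x _ => ⟨univ, φ, isOpen_univ, trivial, hφc.contDiffOn, fun _ _ => rfl⟩,
    fun x _ => ⟨univ, φ, isOpen_univ, trivial, hφc.contDiffOn, fun _ _ => rfl⟩⟩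
  · rintro p ⟨hp, hp1, hp2⟩
    exact ⟨hp, sub_nonneg.2 hp2, sub_le_self _ hp1⟩
  · rintro p ⟨hp, hp1, hp2⟩
    refine ⟨?_, sub_nonneg.2 hp2, sub_le_self _ hp1⟩
    change φ (φ p) ∈ W
    rwa [hφφ]

/-- Translate the second cobordism by `T₁` and glue. Near level `T₁` both pieces are the cylinder
over `c₁` with its structure, so each point of the union has a neighbourhood lying in one piece
extended by its cylinder. -/
theorem Cob.nonempty_comp [Nonempty X] {c₀ c₁ c₂ : Obj θ} (w₁ : Cob c₀ c₁) (w₂ : Cob c₁ c₂) :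
    Nonempty (Cob c₀ c₂) := by
  obtain ⟨ε₁, hε₁, hcol₀, hcol₁⟩ := w₁.exists_collar
  obtain ⟨ε₂, hε₂, hcol₁', hcol₂⟩ := w₂.exists_collar
  have hT₁ := w₁.length_pos
  have hT₂ := w₂.length_pos
  set T₁ := w₁.length with hT₁def
  set T₂ := w₂.length with hT₂def
  set W₁ := w₁.carrier with hW₁def
  obtain ⟨b₁, g₁, hbg₁, hm₁⟩ := BundleMap.exists_isBundleData (V := tangentSpace W₁) w₁.structureMap
  obtain ⟨b₂, g₂, hbg₂, hm₂⟩ :=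
    BundleMap.exists_isBundleData (V := tangentSpace w₂.carrier) w₂.structureMap
  let φ : ℝ × Ell2 → ℝ × Ell2 := fun p => (p.1 - T₁, p.2)
  have hφ : ∀ p, φ p = (-T₁, 0) + ContinuousLinearEquiv.refl ℝ (ℝ × Ell2) p := fun p => by
    ext <;> simp [φ, sub_eq_neg_add]
  have hφc : Continuous φ := by fun_prop
  set W₂ := φ ⁻¹' w₂.carrier with hW₂def
  have hsub₂ : IsSubmanifold 2 W₂ := w₂.isSubmanifold.preimage hφ
  have hcl₂ : IsClosed W₂ := w₂.isClosed.preimage hφc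
  have htan₂ : ∀ p, tangentSpace W₂ p = tangentSpace w₂.carrier (φ p) := fun p => by
    ext u
    exact mem_tangentSpace_preimage_iff hφ
  have hdata₂ : IsBundleData θ W₂ (tangentSpace W₂) (b₂ ∘ φ) (fun x => g₂ (φ x) ∘ₗ LinearMap.id) :=
    hbg₂.pullback hφc.continuousOn (fun x hx => hx) continuousOn_snd
      (fun x hx u hu => htan₂ x ▸ hu) fun x hx u hu h0 => h0
  obtain ⟨δ, hδ, hδ₁, hδ₂, hδT₁, hδT₂⟩ : ∃ δ : ℝ, 0 < δ ∧ δ ≤ ε₁ ∧ δ ≤ ε₂ ∧ δ ≤ T₁ ∧ δ ≤ T₂ :=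
    ⟨min (min ε₁ ε₂) (min T₁ T₂), by positivity, by simp, by simp, by simp, by simp⟩
  have hmid : ∀ p : ℝ × Ell2, T₁ - δ < p.1 → p.1 < T₁ + δ → (p ∈ W₁ ↔ p ∈ W₂) := by
    intro p h1 h2
    rw [hcol₁.1 p (by rw [mem_Ioi]; linarith)]
    exact (hcol₁'.1 (φ p) (by change p.1 - T₁ < ε₂; linarith)).symm
  let W : Set (ℝ × Ell2) := (W₁ ∩ {p | p.1 ≤ T₁}) ∪ (W₂ ∩ {p | T₁ ≤ p.1})
  have hWl : ∀ p : ℝ × Ell2, p.1 < T₁ + δ → (p ∈ W ↔ p ∈ W₁) := by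
    intro p hp
    constructor
    · rintro (h | h)
      · exact h.1
      · exact (hmid p (lt_of_lt_of_le (by linarith) h.2) hp).2 h.1
    · intro h
      rcases le_or_gt p.1 T₁ with h' | h'
      · exact Or.inl ⟨h, h'⟩
      · exact Or.inr ⟨(hmid p (by linarith) hp).1 h, h'.le⟩
  have hWr : ∀ p : ℝ × Ell2, T₁ - δ < p.1 → (p ∈ W ↔ p ∈ W₂) := by
    intro p hp
    constructor
    · rintro (h | h)
      · exact (hmid p hp (lt_of_le_of_lt h.2 (by linarith))).1 h.1
      · exact h.1
    · intro h
      rcases le_or_gt T₁ p.1 with h' | h'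
      · exact Or.inr ⟨h, h'⟩
      · exact Or.inl ⟨(hmid p hp (by linarith)).2 h, h'.le⟩
  have hA : IsOpen {p : ℝ × Ell2 | p.1 < T₁ + δ} := isOpen_lt continuous_fst continuous_const
  have hB : IsOpen {p : ℝ × Ell2 | T₁ - δ < p.1} := isOpen_lt continuous_const continuous_fst
  have hWA : W ∩ {p | p.1 < T₁ + δ} = W₁ ∩ {p | p.1 < T₁ + δ} := by
    ext p
    exact and_congr_left fun hp => hWl p hp
  have hWB : W ∩ {p | T₁ - δ < p.1} = W₂ ∩ {p | T₁ - δ < p.1} := by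
    ext p
    exact and_congr_left fun hp => hWr p hp
  have htA : ∀ p : ℝ × Ell2, p.1 < T₁ + δ → tangentSpace W p = tangentSpace W₁ p := fun p hp =>
    tangentSpace_eq_of_inter_eq (hA.mem_nhds hp) hWA
  have htB : ∀ p : ℝ × Ell2, T₁ - δ < p.1 → tangentSpace W p = tangentSpace W₂ p := fun p hp =>
    tangentSpace_eq_of_inter_eq (hB.mem_nhds hp) hWB
  have hAB : ∀ p : ℝ × Ell2, p.1 < T₁ + δ ∨ T₁ - δ < p.1 := fun p => by
    rcases lt_or_ge p.1 (T₁ + δ) with h | h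
    · exact Or.inl h
    · exact Or.inr (by linarith)
  have hsub : IsSubmanifold 2 W := IsSubmanifold.of_local fun p hp => by
    rcases hAB p with h | h
    · exact ⟨_, W₁, hA, h, w₁.isSubmanifold, hWA⟩
    · exact ⟨_, W₂, hB, h, hsub₂, hWB⟩
  have hmidg : ∀ p ∈ W, T₁ - δ < p.1 → p.1 < T₁ + δ →
      b₁ p = b₂ (φ p) ∧ ∀ u ∈ tangentSpace W p, g₁ p u = g₂ (φ p) u := by
    intro p hp h1 h2
    have hp₁ : p ∈ W₁ := (hWl p h2).1 hp
    have hp₂ : φ p ∈ w₂.carrier := (hWr p h1).1 hp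
    have hS₁ : p.1 ∈ Ioi (T₁ - ε₁) := by rw [mem_Ioi]; linarith
    have hS₂ : (φ p).1 ∈ Iio ε₂ := by change p.1 - T₁ < ε₂; linarith
    have hpc : p.2 ∈ c₁.carrier := (hcol₁.1 p hS₁).1 hp₁
    have a₁ := hcol₁.2 p hp₁ hpc hS₁
    have a₂ := hcol₁'.2 (φ p) hp₂ hpc hS₂
    refine ⟨?_, fun u hu => ?_⟩
    · rw [← (hm₁ p hp₁).1, ← (hm₂ _ hp₂).1, a₁.1, a₂.1]
    · have hu₁ : u ∈ tangentSpace W₁ p := htA p h2 ▸ hu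
      have hu₂ : u ∈ tangentSpace w₂.carrier (φ p) := by
        rw [← htan₂, ← htB p h1]
        exact hu
      have hu' := hcol₁.tangentSpace_le isOpen_Ioi hS₁ hu₁
      rw [← (hm₁ p hp₁).2 u hu₁, ← (hm₂ _ hp₂).2 u hu₂, a₁.2 u hu₁ hu']
      exact (a₂.2 u hu₂ hu').symm
  classical
  -- The switch at `T₁` is harmless: on the overlap the base maps agree, and the linear maps agree
  -- on tangent vectors of `W`.
  let b : ℝ × Ell2 → X := fun p => if p.1 < T₁ then b₁ p else b₂ (φ p)
  let g : ℝ × Ell2 → (ℝ × Ell2) →ₗ[ℝ] Ell2 := fun p => if p.1 < T₁ then g₁ p else g₂ (φ p)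
  have hgl : ∀ p ∈ W, p.1 < T₁ + δ → b p = b₁ p ∧ ∀ u ∈ tangentSpace W p, g p u = g₁ p u := by
    intro p hp h
    by_cases h' : p.1 < T₁
    · simp only [b, g, if_pos h', implies_true, and_self]
    · simp only [b, g, if_neg h']
      have := hmidg p hp (by linarith) h
      exact ⟨this.1.symm, fun u hu => (this.2 u hu).symm⟩
  have hgr : ∀ p ∈ W, T₁ - δ < p.1 →
      b p = b₂ (φ p) ∧ ∀ u ∈ tangentSpace W p, g p u = g₂ (φ p) u := by
    intro p hp h
    by_cases h' : p.1 < T₁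
    · simp only [b, g, if_pos h']
      exact hmidg p hp h (by linarith)
    · simp only [b, g, if_neg h', implies_true, and_self]
  have hdata : IsBundleData θ W (tangentSpace W) b g := IsBundleData.of_local fun p hp => by
    rcases hAB p with h | h
    · exact ⟨_, b₁, g₁, hA, h, hbg₁.mono (fun q hq => (hWl q hq.2).1 hq.1)
        (fun q hq => (htA q hq.2).le), fun q hq => hgl q hq.1 hq.2⟩
    · exact ⟨_, _, _, hB, h, hdata₂.mono (fun q hq => (hWr q hq.2).1 hq.1)
        (fun q hq => (htB q hq.2).le), fun q hq => hgr q hq.1 hq.2⟩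
  obtain ⟨m, hm⟩ := hdata.exists_bundleMap two_pos fun x hx => hsub.finrank_tangentSpace hx
  obtain ⟨n₁, hn₁⟩ := w₁.exists_subset
  obtain ⟨n₂, hn₂⟩ := w₂.exists_subset
  refine ⟨{ length := T₁ + T₂
            length_pos := by positivity
            carrier := W
            isSubmanifold := hsub
            isClosed := (w₁.isClosed.inter (isClosed_le continuous_fst continuous_const)).union
              (hcl₂.inter (isClosed_le continuous_const continuous_fst))
            exists_subset := ⟨max n₁ n₂, ?_⟩
            mem_cube := ?_
            structureMap := m
            exists_collar := ⟨δ, hδ, ⟨fun p hp => ?_, fun p hpW hpc hpS => ?_⟩,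
              ⟨fun p hp => ?_, fun p hpW hpc hpS => ?_⟩⟩ }⟩
  · rintro p (hp | hp) i hi
    · exact hn₁ p hp.1 i ((le_max_left _ _).trans hi)
    · exact hn₂ (φ p) hp.1 i ((le_max_right _ _).trans hi)
  · rintro p (hp | hp)
    · exact w₁.mem_cube p hp.1
    · exact w₂.mem_cube (φ p) hp.1
  · rw [mem_Iio] at hp
    rw [hWl p (by linarith)]
    exact hcol₀.1 p (by rw [mem_Iio]; linarith)
  · rw [mem_Iio] at hpS
    have hlt : p.1 < T₁ + δ := by linarith
    have hpW₁ : p ∈ W₁ := (hWl p hlt).1 hpW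
    have ha := hcol₀.2 p hpW₁ hpc (by rw [mem_Iio]; linarith)
    have hg := hgl p hpW hlt
    refine ⟨?_, fun u hu hu' => ?_⟩
    · rw [(hm p hpW).1, hg.1, ← (hm₁ p hpW₁).1, ha.1]
    · have hu₁ : u ∈ tangentSpace W₁ p := htA p hlt ▸ hu
      rw [(hm p hpW).2 u hu, hg.2 u hu, ← (hm₁ p hpW₁).2 u hu₁, ha.2 u hu₁ hu']
  · rw [mem_Ioi] at hp
    rw [hWr p (by linarith)]
    exact hcol₂.1 (φ p) (by change T₂ - ε₂ < p.1 - T₁; linarith)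
  · rw [mem_Ioi] at hpS
    have hlt : T₁ - δ < p.1 := by linarith
    have hpW₂ : φ p ∈ w₂.carrier := (hWr p hlt).1 hpW
    have ha := hcol₂.2 (φ p) hpW₂ hpc (by change T₂ - ε₂ < p.1 - T₁; linarith)
    have hg := hgr p hpW hlt
    refine ⟨?_, fun u hu hu' => ?_⟩
    · rw [(hm p hpW).1, hg.1, ← (hm₂ _ hpW₂).1, ha.1]
    · have hu₂ : u ∈ tangentSpace w₂.carrier (φ p) := by
        rw [← htan₂, ← htB p hlt]
        exact hu
      rw [(hm p hpW).2 u hu, hg.2 u hu, ← (hm₂ _ hpW₂).2 u hu₂]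
      exact ha.2 u hu₂ hu'

theorem Hom.nonempty_comp [Nonempty X] {c₀ c₁ c₂ : Obj θ} (f : Hom c₀ c₁) (f' : Hom c₁ c₂) :
    Nonempty (Hom c₀ c₂) := by
  cases f with
  | id => exact ⟨f'⟩
  | cob w =>
    cases f' with
    | id => exact ⟨.cob w⟩
    | cob w' => exact (w.nonempty_comp w').map Hom.cob

theorem Hom.nonempty_reverse [Nonempty X] (hN : ∀ f ∈ frameSet θ, ReflLoopNull θ f)
    {c₀ c₁ : Obj θ} (f : Hom c₀ c₁) : Nonempty (Hom c₁ c₀) := by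
  cases f with
  | id => exact ⟨.id _⟩
  | cob w => exact ⟨.cob (w.exists_reverse hN).choose⟩

/-- Every arrow pointing backwards is replaced by a reverse, and the resulting chain is composed. -/
theorem Zigzag.nonempty_hom [Nonempty X] (hN : ∀ f ∈ frameSet θ, ReflLoopNull θ f)
    {c₀ c₁ : Obj θ} (h : Zigzag c₀ c₁) : Nonempty (Hom c₀ c₁) := by
  induction h with
  | refl => exact ⟨.id _⟩
  | tail _ hbc ih =>
    obtain ⟨f⟩ := ih
    rcases hbc with ⟨⟨f'⟩⟩ | ⟨⟨f'⟩⟩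
    · exact f.nonempty_comp f'
    · exact (f'.nonempty_reverse hN).elim fun f'' => f.nonempty_comp f''

end Category

end CobCat

end

/-! ### The main theorem -/

theorem mainTheorem9 {X : Type*} [TopologicalSpace X] [PathConnectedSpace X]
    (θ : C(X, CobCat.BO 2)) (hθ : CobCat.IsSerreFibration θ)
    (hS : Nonempty (CobCat.ThetaStructure θ
      (Metric.sphere (0 : EuclideanSpace ℝ (Fin 3)) 1))) :
    (∀ (c₀ c₁ : CobCat.Obj θ) (w : CobCat.Cob c₀ c₁), IsConnected w.underlying →
      ∃ w' : CobCat.Cob c₁ c₀, CobCat.Diffeomorphic w'.underlying w.underlying) ∧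
    (∀ c₀ c₁ : CobCat.Obj θ, CobCat.Zigzag c₀ c₁ →
      Nonempty (CobCat.Hom c₀ c₁) ∧ Nonempty (CobCat.Hom c₁ c₀)) := by
  have hN : ∀ f ∈ CobCat.frameSet θ, CobCat.ReflLoopNull θ f :=
    fun f hf => CobCat.reflLoopNull_of_sphere hS hf
  refine ⟨fun c₀ c₁ w _ => w.exists_reverse hN, fun c₀ c₁ h => ?_⟩
  have h₁ := h.nonempty_hom hN
  exact ⟨h₁, h₁.elim fun f => f.nonempty_reverse hN⟩
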